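/- Let $\Bbbk=\mathbb{C}(q)[q^{\pm\beta}]$ be the ring of Laurent polynomials over the field $\mathbb{C}(q)$ in a formal variable $q^{\beta}$, and put $[\beta]=\frac{q^{\beta}-q^{-\beta}}{q-q^{-1}}\in\Bbbk$. Let $\mathsf{Tangles}$ be the strict monoidal category of oriented framed tangles modulo isotopy: objects are finite sequences in $\{\uparrow,\downarrow\}$, and morphisms are oriented tangle diagrams with blackboard framing, read from bottom to top, modulo planar isotopy and the framed Reidemeister moves; composition is stacking and the tensor product is juxtaposition. Let $\mathsf{Br}(\beta)$ be the quotient of its $\Bbbk$-linearization by the tensor ideal generated by the following relations: * $X-Y=(q^{-1}-q)\,\mathrm{id}_{\uparrow\uparrow}$, where $X$ (resp. $Y$) is the crossing of two upward strands in which the strand from bottom left to top right passes over (resp. under) the other; * a circle, with either orientation, equals $[\beta]$; * an upward strand with one curl, to the left or to the right, equals $q^{-\beta}$ times the straight strand if the crossing of the curl is $X$, and $q^{\beta}$ times the straight strand if it is $Y$. Let $\mathcal{Q}_\beta\colon\mathsf{Tangles}\to\mathsf{Br}(\beta)$ be the canonical functor. Then the map $\Bbbk\to\operatorname{End}_{\mathsf{Br}(\beta)}(\varnothing)$,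 $p\mapsto p\cdot\mathrm{id}_\varnothing$, is bijective, so that for every oriented framed link $L$ (a tangle without endpoints) the (uncoloured) HOMFLY-PT polynomial $P_\beta(L)\in\Bbbk$ is well defined by $\mathcal{Q}_\beta(L)=P_\beta(L)\cdot\mathrm{id}_\varnothing$. Moreover, for every oriented framed link $L$, $$P_\beta(L)(q,q^{\beta})=P_\beta(L)(-q^{-1},q^{\beta}),$$ where the right-hand side is the image of $P_\beta(L)$ under the $\mathbb{C}$-algebra endomorphism of $\Bbbk$ with $q\mapsto -q^{-1}$ and $q^{\beta}\mapsto q^{\beta}$. -/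

import Mathlib

open scoped LaurentPolynomial

namespace Homfly

/-! ### The ground ring `ℂ(q)[q^{±β}]` -/

/-- The ring `𝕜 = ℂ(q)[q^{±β}]`: Laurent polynomials over `ℂ(q)` in a formal variable `q^β`. -/
abbrev BaseRing : Type := LaurentPolynomial (RatFunc ℂ)

/-- The element `q` of `𝕜`. -/
noncomputable def q : BaseRing := LaurentPolynomial.C RatFunc.X

/-- The element `q⁻¹` of `𝕜`. -/
noncomputable def qInv : BaseRing := LaurentPolynomial.C (RatFunc.X)⁻¹

/-- The element `q^{mβ}` of `𝕜`, for an integer `m`. -/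
noncomputable def qBeta (m : ℤ) : BaseRing := LaurentPolynomial.T m

/-- The element `[β] = (q^β - q^{-β}) / (q - q⁻¹)` of `𝕜`. -/
noncomputable def betaNumber : BaseRing :=
  LaurentPolynomial.C ((RatFunc.X : RatFunc ℂ) - (RatFunc.X)⁻¹)⁻¹ * (qBeta 1 - qBeta (-1))

theorem transcendental_neg_inv_X : Transcendental ℂ (-(RatFunc.X : RatFunc ℂ)⁻¹) := by
  intro h
  have h2 : IsAlgebraic ℂ (RatFunc.X : RatFunc ℂ) := by
    simpa using (IsAlgebraic.neg h).inv
  exact RatFunc.transcendental_X h2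

/-- The endomorphism `f(q) ↦ f(-q⁻¹)` of the field `ℂ(q)`. -/
noncomputable def ratFuncFlip : RatFunc ℂ →ₐ[ℂ] RatFunc ℂ :=
  (IntermediateField.val _).comp
    (RatFunc.algEquivOfTranscendental (-(RatFunc.X : RatFunc ℂ)⁻¹)
      transcendental_neg_inv_X).toAlgHom

/-- The substitution `f(q, q^β) ↦ f(-q⁻¹, q^β)`, a ring endomorphism of `𝕜`. -/
noncomputable def qFlip : BaseRing →+* BaseRing :=
  AddMonoidAlgebra.mapRingHom ℤ ratFuncFlip.toRingHom

theorem ratFuncFlip_X : ratFuncFlip RatFunc.X = -(RatFunc.X)⁻¹ := by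
  simp [ratFuncFlip]

theorem qFlip_q : qFlip q = -qInv := by
  change AddMonoidAlgebra.mapRingHom ℤ ratFuncFlip.toRingHom (AddMonoidAlgebra.single 0 _) = _
  rw [AddMonoidAlgebra.mapRingHom_single]
  change LaurentPolynomial.C (ratFuncFlip RatFunc.X) = _
  rw [ratFuncFlip_X, map_neg]
  rfl

theorem qFlip_qBeta (m : ℤ) : qFlip (qBeta m) = qBeta m := by
  change AddMonoidAlgebra.mapRingHom ℤ ratFuncFlip.toRingHom (AddMonoidAlgebra.single m 1) = _
  rw [AddMonoidAlgebra.mapRingHom_single, map_one]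
  rfl

/-! ### Oriented framed tangles -/

/-- The two orientations `↑` and `↓` of a strand at an endpoint. -/
inductive Orientation : Type
  | up
  | down

/-- Sliced oriented tangle diagrams, read from bottom to top, with the blackboard framing.
`Diagram s t` consists of the diagrams with bottom endpoints `s` and top endpoints `t`.
They are built from identities, cups, caps and crossings, by stacking (`comp f g` is `g` on top of
`f`) and by horizontal juxtaposition. A cup or cap joins two endpoints of opposite
orientations. In `cross o a b` the strand with bottom endpoint `a` runs from the bottom left to the
top right, the strand with bottom endpoint `b` runs from the bottom right to the top left, and the
former passes over the latter if `o = true`, under it if `o = false`. -/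
inductive Diagram : List Orientation → List Orientation → Type
  | id (s : List Orientation) : Diagram s s
  | cup {a b : Orientation} (h : a ≠ b) : Diagram [] [a, b]
  | cap {a b : Orientation} (h : a ≠ b) : Diagram [a, b] []
  | cross (o : Bool) (a b : Orientation) : Diagram [a, b] [b, a]
  | comp {s t u : List Orientation} (f : Diagram s t) (g : Diagram t u) : Diagram s u
  | tensor {s t s' t' : List Orientation} (f : Diagram s t) (g : Diagram s' t') :
      Diagram (s ++ s') (t ++ t')

namespace Diagram

/-- Isotopy of oriented framed tangle diagrams: the equivalence relation generated by the laws of a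
strict monoidal category (planar isotopies that preserve the slicing up to heights), the
straightening of a strand, the second and third Reidemeister moves, the passage of a strand over or
under a maximum or a minimum, and the framed first Reidemeister move.
The relation is stated for diagrams with arbitrary endpoints only because `(s ++ t) ++ u` and
`s ++ (t ++ u)` are different expressions; related diagrams always have equal endpoints. -/
inductive Isotopic : ∀ {s t s' t' : List Orientation}, Diagram s t → Diagram s' t' → Prop
  | refl {s t : List Orientation} (f : Diagram s t) : Isotopic f f
  | symm {s t s' t' : List Orientation} {f : Diagram s t} {g : Diagram s' t'} :
      Isotopic f g → Isotopic g f
  | trans {s t s' t' s'' t'' : List Orientation} {f : Diagram s t} {g : Diagram s' t'}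
      {h : Diagram s'' t''} : Isotopic f g → Isotopic g h → Isotopic f h
  | comp_congr {s t u s' t' u' : List Orientation} {f : Diagram s t} {g : Diagram t u}
      {f' : Diagram s' t'} {g' : Diagram t' u'} :
      Isotopic f f' → Isotopic g g' → Isotopic (comp f g) (comp f' g')
  | tensor_congr {s t u v s' t' u' v' : List Orientation} {f : Diagram s t} {g : Diagram u v}
      {f' : Diagram s' t'} {g' : Diagram u' v'} :
      Isotopic f f' → Isotopic g g' → Isotopic (tensor f g) (tensor f' g')
  -- the laws of a strict monoidal category
  | id_comp {s t : List Orientation} (f : Diagram s t) : Isotopic (comp (id s) f) f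
  | comp_id {s t : List Orientation} (f : Diagram s t) : Isotopic (comp f (id t)) f
  | comp_assoc {s t u v : List Orientation} (f : Diagram s t) (g : Diagram t u)
      (h : Diagram u v) : Isotopic (comp (comp f g) h) (comp f (comp g h))
  | tensor_id (s t : List Orientation) : Isotopic (tensor (id s) (id t)) (id (s ++ t))
  | tensor_comp {s t u s' t' u' : List Orientation} (f : Diagram s t) (g : Diagram t u)
      (f' : Diagram s' t') (g' : Diagram t' u') :
      Isotopic (tensor (comp f g) (comp f' g')) (comp (tensor f f') (tensor g g'))
  | unit_tensor {s t : List Orientation} (f : Diagram s t) : Isotopic (tensor (id []) f) f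
  | tensor_unit {s t : List Orientation} (f : Diagram s t) : Isotopic (tensor f (id [])) f
  | tensor_assoc {s t s' t' s'' t'' : List Orientation} (f : Diagram s t) (g : Diagram s' t')
      (h : Diagram s'' t'') : Isotopic (tensor (tensor f g) h) (tensor f (tensor g h))
  -- straightening a strand
  | zigzag_left {a b : Orientation} (h : a ≠ b) :
      Isotopic (comp (tensor (id [a]) (cup h.symm) :) (tensor (cap h) (id [a]) :)) (id [a])
  | zigzag_right {a b : Orientation} (h : a ≠ b) :
      Isotopic (comp (tensor (cup h) (id [a]) :) (tensor (id [a]) (cap h.symm) :)) (id [a])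
  -- the second Reidemeister move
  | reidemeister_two (o : Bool) (a b : Orientation) :
      Isotopic (comp (cross o a b) (cross (!o) b a)) (id [a, b])
  -- the third Reidemeister move
  | reidemeister_three (o : Bool) (a b c : Orientation) :
      Isotopic
        (comp (tensor (cross o a b) (id [c]) :)
          (comp (tensor (id [b]) (cross o a c) :) (tensor (cross o b c) (id [a]) :)))
        (comp (tensor (id [a]) (cross o b c) :)
          (comp (tensor (cross o a c) (id [b]) :) (tensor (id [c]) (cross o a b) :)))
  -- a strand passes under (`o = true`) or over (`o = false`) a maximum or a minimum
  | slide_cap (o : Bool) {a b : Orientation} (h : a ≠ b) (c : Orientation) :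
      Isotopic (tensor (cap h) (id [c]) :)
        (comp (tensor (id [a]) (cross o b c) :)
          (comp (tensor (cross o a c) (id [b]) :) (tensor (id [c]) (cap h) :)))
  | slide_cup (o : Bool) {a b : Orientation} (h : a ≠ b) (c : Orientation) :
      Isotopic (tensor (id [c]) (cup h) :)
        (comp (tensor (cup h) (id [c]) :)
          (comp (tensor (id [a]) (cross o b c) :) (tensor (cross o a c) (id [b]) :)))
  -- the framed first Reidemeister move: a curl to the right is a curl to the left
  | reidemeister_one (o : Bool) {a b : Orientation} (h : a ≠ b) :
      Isotopic
        (comp (tensor (id [a]) (cup h) :)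
          (comp (tensor (cross o a a) (id [b]) :) (tensor (id [a]) (cap h) :)))
        (comp (tensor (cup h.symm) (id [a]) :)
          (comp (tensor (id [b]) (cross o a a) :) (tensor (cap h.symm) (id [a]) :)))

/-- Isotopy as an equivalence relation on the diagrams with given endpoints. -/
instance isotopySetoid (s t : List Orientation) : Setoid (Diagram s t) where
  r f g := Isotopic f g
  iseqv := ⟨fun f => .refl f, fun h => .symm h, fun h h' => .trans h h'⟩

end Diagram

/-- Oriented framed tangles from `s` to `t`, modulo isotopy: the morphisms of the strict monoidal
category of oriented framed tangles. -/
def Tangle (s t : List Orientation) : Type := Quotient (Diagram.isotopySetoid s t)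

namespace Tangle

/-- The tangle represented by a diagram. -/
def mk {s t : List Orientation} (f : Diagram s t) : Tangle s t := Quotient.mk _ f

/-- The identity tangle: vertical strands. -/
def id (s : List Orientation) : Tangle s s := mk (.id s)

/-- Composition of tangles: `comp f g` is `g` stacked on top of `f`. -/
def comp {s t u : List Orientation} (f : Tangle s t) (g : Tangle t u) : Tangle s u :=
  Quotient.map₂ Diagram.comp (fun _ _ h _ _ h' => .comp_congr h h') f g

/-- Tensor product of tangles: horizontal juxtaposition. -/
def tensor {s t s' t' : List Orientation} (f : Tangle s t) (g : Tangle s' t') :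
    Tangle (s ++ s') (t ++ t') :=
  Quotient.map₂ Diagram.tensor (fun _ _ h _ _ h' => .tensor_congr h h') f g

end Tangle

/-- Oriented framed links are the tangles without endpoints. -/
abbrev FramedLink : Type := Tangle [] []

/-- The morphism spaces of the `𝕜`-linear category of tangles: formal linear combinations. -/
abbrev LinTangle (s t : List Orientation) : Type := Tangle s t →₀ BaseRing

/-- A diagram, as an element of the `𝕜`-linear category of tangles. -/
noncomputable def diag {s t : List Orientation} (f : Diagram s t) : LinTangle s t :=
  Finsupp.single (Tangle.mk f) 1

/-! ### The quantized oriented Brauer category with generic parameter -/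

section
open Homfly.Diagram Homfly.Orientation

/-- The defining relations of the quantized oriented Brauer category `Br(β)`; `Relator s t r` means
that `r = 0` is imposed on the morphisms from `s` to `t`. -/
inductive Relator : ∀ s t : List Orientation, LinTangle s t → Prop
  /-- over-crossing minus under-crossing is `(q⁻¹ - q)` times the identity -/
  | skein : Relator [up, up] [up, up]
      (diag (cross true up up) - diag (cross false up up) - (qInv - q) • diag (id [up, up]))
  /-- a circle, with either orientation, is `[β]` -/
  | circle {a b : Orientation} (h : a ≠ b) : Relator [] []
      (diag (comp (cup h) (cap h)) - betaNumber • diag (id []))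
  /-- a curl to the right is `q^{-β}` or `q^{β}`, according to the crossing -/
  | curl_right (o : Bool) (h : up ≠ down) : Relator [up] [up]
      ((diag (comp (tensor (id [up]) (cup h) :)
          (comp (tensor (cross o up up) (id [down]) :) (tensor (id [up]) (cap h) :))) : LinTangle [up] [up])
        - qBeta (if o then -1 else 1) • diag (id [up]))
  /-- a curl to the left is `q^{-β}` or `q^{β}`, according to the crossing -/
  | curl_left (o : Bool) (h : down ≠ up) : Relator [up] [up]
      ((diag (comp (tensor (cup h) (id [up]) :)
          (comp (tensor (id [down]) (cross o up up) :) (tensor (cap h) (id [up]) :))) : LinTangle [up] [up])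
        - qBeta (if o then -1 else 1) • diag (id [up]))

end

/-- Placing a tangle `T` inside a larger tangle: `T` with vertical strands `u` on its left and `v`
on its right, with `f` below and `g` on top; extended `𝕜`-linearly in `T`. -/
noncomputable def plug {s t x y : List Orientation} (u v : List Orientation)
    (f : Tangle s (u ++ x ++ v)) (g : Tangle (u ++ y ++ v) t) :
    LinTangle x y →ₗ[BaseRing] LinTangle s t :=
  Finsupp.lmapDomain BaseRing BaseRing fun T =>
    Tangle.comp (Tangle.comp f (Tangle.tensor (Tangle.tensor (Tangle.id u) T) (Tangle.id v))) g

/-- The morphisms from `s` to `t` in the tensor ideal that the defining relations generate. -/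
noncomputable def relatorIdeal (s t : List Orientation) :
    Submodule BaseRing (LinTangle s t) :=
  Submodule.span BaseRing
    {z | ∃ (x y u v : List Orientation) (f : Tangle s (u ++ x ++ v)) (g : Tangle (u ++ y ++ v) t)
      (r : LinTangle x y), Relator x y r ∧ z = plug u v f g r}

/-- The morphism spaces of the quantized oriented Brauer category `Br(β)`. -/
abbrev BrHom (s t : List Orientation) : Type := LinTangle s t ⧸ relatorIdeal s t

/-- The quotient functor `𝒬_β` from tangles to `Br(β)`, on morphisms. -/
noncomputable def quotientFunctor {s t : List Orientation} (f : Tangle s t) : BrHom s t :=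
  (relatorIdeal s t).mkQ (Finsupp.single f 1)

/-- The canonical map `𝕜 → End_{Br(β)}(∅)`, sending `p` to `p` times the identity. -/
noncomputable def scalarEnd : BaseRing →ₗ[BaseRing] BrHom [] [] :=
  LinearMap.toSpanSingleton BaseRing (BrHom [] []) (quotientFunctor (Tangle.id []))

/-- The HOMFLY-PT polynomial `P_β(L)`: the image `𝒬_β(L)` in `End_{Br(β)}(∅)`, regarded as an
element of `𝕜` through the inverse of the canonical map `𝕜 → End_{Br(β)}(∅)`. (That the latter is
bijective is part of the theorem.) -/
noncomputable def homfly (L : FramedLink) : BaseRing :=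
  Function.invFun scalarEnd (quotientFunctor L)

end Homfly

/-!
# The HOMFLY-PT polynomial and its symmetry under `q ↦ -q⁻¹`

Once the canonical map `𝕜 → End(∅)` is known to be bijective, the symmetry is formal: the
coefficients `q⁻¹ - q`, `[β]` and `q^{±β}` of the defining relations of `Br(β)` are invariant under
`q ↦ -q⁻¹`, so this substitution acts on `Br(β)` coefficientwise and fixes all tangles
(`scalarEnd_qFlip`). The content is bijectivity, that is, the existence and uniqueness of the
HOMFLY-PT polynomial.

*Calculus of diagrams.* Endpoints that agree only up to associativity of lists make stacking of
diagrams awkward. Instead, diagrams act on a single set (`DiagramAction`), either the product of the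
morphism spaces of `Br(β)` out of the empty sequence (`brAction`) or the words in `N` colours
(`Weights.action`). In any action in which the moves other than the third Reidemeister move hold,
crossings can be rotated, and the third Reidemeister move for upward strands implies the one for all
orientations (`DiagramAction.Slides.cross_of_all_up`).

*Surjectivity* (`scalarEnd_surjective`). Consider the span of the diagrams obtained from the empty
one by adding arcs, each on top of all the previous ones. It is stable under minima, maxima and
crossings, by induction on the number of endpoints
(`DiagramAction.IsSkein.crossClosed_and_capClosed`): by the skein relation a crossing may be changed
at will, modulo a minimum on top of a maximum or the identity; a maximum or a suitably chosen
crossing meeting the top arc shortens, lengthens, straightens or closes this arc, and all others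
slide through it. Without endpoints the span consists of the multiples of the empty diagram, so
every link is a scalar.

*Injectivity* (`scalarEnd_injective`). For each `N` the vector representation of the quantum group
of `gl(N)` gives a state sum that is invariant under isotopy (`Gl.sameMatrix_of_isotopic`) and
satisfies the defining relations of `Br(β)` with `q^β` replaced by `q^N` (`linCol_relator`). So a
Laurent polynomial `p` in `q^β` with `p · id = 0` vanishes at `q^β = q^N` for all `N`; these are
infinitely many points of the field `ℂ(q)`, and `p = 0`.
-/

namespace Homfly

/-! ### Diagrammatic calculus without types -/

/-- A relation between diagrams with arbitrary endpoints that is compatible with stacking and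
juxtaposition and satisfies the laws of a strict monoidal category. -/
structure MonoidalCongruence
    (r : ∀ {s t s' t' : List Orientation}, Diagram s t → Diagram s' t' → Prop) : Prop where
  refl {s t : List Orientation} (f : Diagram s t) : r f f
  symm {s t s' t' : List Orientation} {f : Diagram s t} {g : Diagram s' t'} : r f g → r g f
  trans {s t s' t' s'' t'' : List Orientation} {f : Diagram s t} {g : Diagram s' t'}
    {h : Diagram s'' t''} : r f g → r g h → r f h
  comp_congr {s t u s' t' u' : List Orientation} {f : Diagram s t} {g : Diagram t u}
    {f' : Diagram s' t'} {g' : Diagram t' u'} : r f f' → r g g' → r (.comp f g) (.comp f' g')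
  tensor_congr {s t u v s' t' u' v' : List Orientation} {f : Diagram s t} {g : Diagram u v}
    {f' : Diagram s' t'} {g' : Diagram u' v'} :
    r f f' → r g g' → r (.tensor f g) (.tensor f' g')
  id_comp {s t : List Orientation} (f : Diagram s t) : r (.comp (.id s) f) f
  comp_id {s t : List Orientation} (f : Diagram s t) : r (.comp f (.id t)) f
  comp_assoc {s t u v : List Orientation} (f : Diagram s t) (g : Diagram t u) (h : Diagram u v) :
    r (.comp (.comp f g) h) (.comp f (.comp g h))
  tensor_id (s t : List Orientation) : r (.tensor (.id s) (.id t)) (.id (s ++ t))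
  tensor_comp {s t u s' t' u' : List Orientation} (f : Diagram s t) (g : Diagram t u)
    (f' : Diagram s' t') (g' : Diagram t' u') :
    r (.tensor (.comp f g) (.comp f' g')) (.comp (.tensor f f') (.tensor g g'))
  unit_tensor {s t : List Orientation} (f : Diagram s t) : r (.tensor (.id []) f) f
  tensor_unit {s t : List Orientation} (f : Diagram s t) : r (.tensor f (.id [])) f
  tensor_assoc {s t s' t' s'' t'' : List Orientation} (f : Diagram s t) (g : Diagram s' t')
    (h : Diagram s'' t'') : r (.tensor (.tensor f g) h) (.tensor f (.tensor g h))

/-- The diagram `K` with vertical strands `p` on its left and `u` on its right. -/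
def whisker (p : List Orientation) {s t : List Orientation} (K : Diagram s t)
    (u : List Orientation) : Diagram (p ++ s ++ u) (p ++ t ++ u) :=
  .tensor (.tensor (.id p) K) (.id u)

/-- Diagrams acting on the elements of one fixed set `E`, whatever their endpoints, in a way that
depends only on the class of a diagram under a monoidal congruence. Two diagrams that cannot be
stacked may still act one after the other; this is what removes from the calculus all
identifications between differently associated lists of endpoints. -/
structure DiagramAction (E : Type*) where
  /-- the congruence -/
  rel : ∀ {s t s' t' : List Orientation}, Diagram s t → Diagram s' t' → Prop
  /-- the action of a diagram -/
  act : ∀ {s t : List Orientation}, Diagram s t → E → E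
  isCongr : MonoidalCongruence rel
  act_congr : ∀ {s t s' t' : List Orientation} {f : Diagram s t} {g : Diagram s' t'},
    rel f g → act f = act g
  act_comp : ∀ {s t u : List Orientation} (f : Diagram s t) (g : Diagram t u) (x : E),
    act (.comp f g) x = act g (act f x)

namespace DiagramAction

variable {E : Type*} (A : DiagramAction E) {s t s' t' : List Orientation}

/-- The action of a diagram with vertical strands `p` on its left and `u` on its right. -/
def slice (p : List Orientation) (K : Diagram s t) (u : List Orientation) (x : E) : E :=
  A.act (whisker p K u) x

/-- The action of the identity of `l`. It is not the identity map of `E`: elements of `E` that do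
not end in `l` are usually killed. -/
def unit (l : List Orientation) (x : E) : E := A.act (.id l) x

theorem slice_congr {K : Diagram s t} {K' : Diagram s' t'} (h : A.rel K K')
    (p u : List Orientation) (x : E) : A.slice p K u x = A.slice p K' u x := by
  have C := A.isCongr
  exact congrFun (A.act_congr (C.tensor_congr (C.tensor_congr (C.refl _) h) (C.refl _))) x

theorem slice_id (p l u : List Orientation) (x : E) :
    A.slice p (.id l) u x = A.unit (p ++ l ++ u) x := by
  have C := A.isCongr
  unfold slice unit whisker
  rw [A.act_congr (C.trans (C.tensor_congr (C.tensor_id p l) (C.refl (.id u))) (C.tensor_id _ _))]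

theorem slice_comp {w : List Orientation} (p : List Orientation) (f : Diagram s t)
    (g : Diagram t w) (u : List Orientation) (x : E) :
    A.slice p (.comp f g) u x = A.slice p g u (A.slice p f u x) := by
  have C := A.isCongr
  unfold slice whisker
  rw [← A.act_comp]
  refine congrFun (A.act_congr ?_) x
  refine C.trans (C.tensor_congr (C.trans (C.tensor_congr (C.symm (C.id_comp _)) (C.refl _))
    (C.tensor_comp _ _ _ _)) (C.symm (C.id_comp _))) (C.tensor_comp _ _ _ _)

theorem slice_tensor_left (p y : List Orientation) (K : Diagram s t) (u : List Orientation)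
    (x : E) : A.slice p (.tensor (.id y) K) u x = A.slice (p ++ y) K u x := by
  have C := A.isCongr
  unfold slice whisker
  refine congrFun (A.act_congr (C.tensor_congr (C.trans (C.symm (C.tensor_assoc _ _ _)) ?_)
    (C.refl _))) x
  exact C.tensor_congr (C.tensor_id p y) (C.refl K)

theorem slice_tensor_right (p y : List Orientation) (K : Diagram s t) (u : List Orientation)
    (x : E) : A.slice p (.tensor K (.id y)) u x = A.slice p K (y ++ u) x := by
  have C := A.isCongr
  unfold slice whisker
  refine congrFun (A.act_congr ?_) x
  exact C.trans (C.tensor_congr (C.symm (C.tensor_assoc _ _ _)) (C.refl _))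
    (C.trans (C.tensor_assoc _ _ _) (C.tensor_congr (C.refl _) (C.tensor_id _ _)))

/-- Juxtaposed diagrams act independently of their relative heights. -/
theorem slice_tensor (p : List Orientation) (f : Diagram s t) (g : Diagram s' t')
    (u : List Orientation) (x : E) :
    A.slice p (.tensor f g) u x = A.slice (p ++ t) g u (A.slice p f (s' ++ u) x) ∧
    A.slice p (.tensor f g) u x = A.slice p f (t' ++ u) (A.slice (p ++ s) g u x) := by
  have C := A.isCongr
  constructor
  · rw [← slice_tensor_left, ← slice_tensor_right, ← slice_comp]
    exact A.slice_congr (C.trans (C.tensor_congr (C.symm (C.comp_id _)) (C.symm (C.id_comp _)))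
      (C.tensor_comp _ _ _ _)) _ _ _
  · rw [← slice_tensor_left, ← slice_tensor_right, ← slice_comp]
    exact A.slice_congr (C.trans (C.tensor_congr (C.symm (C.id_comp _)) (C.symm (C.comp_id _)))
      (C.tensor_comp _ _ _ _)) _ _ _

theorem slice_comm (p m u : List Orientation) (f : Diagram s t) (g : Diagram s' t') (x : E) :
    A.slice (p ++ t ++ m) g u (A.slice p f (m ++ s' ++ u) x) =
      A.slice p f (m ++ t' ++ u) (A.slice (p ++ s ++ m) g u x) := by
  have h := A.slice_tensor p (.tensor f (.id m)) g u x
  rw [slice_tensor_right, slice_tensor_right] at h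
  simpa using h.1.symm.trans h.2

theorem slice_unit (p : List Orientation) (K : Diagram s t) (u l : List Orientation)
    (h : l = p ++ s ++ u) (x : E) : A.slice p K u (A.unit l x) = A.slice p K u x := by
  subst h
  rw [← slice_id, ← slice_comp]
  exact A.slice_congr (A.isCongr.id_comp _) _ _ _

theorem unit_slice (p : List Orientation) (K : Diagram s t) (u l : List Orientation)
    (h : l = p ++ t ++ u) (x : E) : A.unit l (A.slice p K u x) = A.slice p K u x := by
  subst h
  rw [← slice_id, ← slice_comp]
  exact A.slice_congr (A.isCongr.comp_id _) _ _ _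

theorem unit_unit (l : List Orientation) (x : E) : A.unit l (A.unit l x) = A.unit l x := by
  unfold unit
  rw [← act_comp, A.act_congr (A.isCongr.id_comp _)]

theorem slice_nil (K : Diagram s t) (x : E) : A.slice [] K [] x = A.act K x := by
  have C := A.isCongr
  unfold slice whisker
  exact congrFun (A.act_congr (C.trans (C.tensor_unit _) (C.unit_tensor _))) x

end DiagramAction
end Homfly

namespace Homfly
namespace DiagramAction
open Diagram

variable {E : Type*}

/-- The congruence of the action contains the straightening of strands, the second Reidemeister
move and the passage of strands over and under maxima and minima, for all orientations. -/
structure IsBraided (A : DiagramAction E) : Prop where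
  zigzag_left {a b : Orientation} (h : a ≠ b) :
    A.rel (comp (tensor (id [a]) (cup h.symm) :) (tensor (cap h) (id [a]) :)) (id [a])
  zigzag_right {a b : Orientation} (h : a ≠ b) :
    A.rel (comp (tensor (cup h) (id [a]) :) (tensor (id [a]) (cap h.symm) :)) (id [a])
  reidemeister_two (o : Bool) (a b : Orientation) :
    A.rel (comp (cross o a b) (cross (!o) b a)) (id [a, b])
  slide_cap (o : Bool) {a b : Orientation} (h : a ≠ b) (c : Orientation) :
    A.rel (tensor (cap h) (id [c]) :)
      (comp (tensor (id [a]) (cross o b c) :)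
        (comp (tensor (cross o a c) (id [b]) :) (tensor (id [c]) (cap h) :)))
  slide_cup (o : Bool) {a b : Orientation} (h : a ≠ b) (c : Orientation) :
    A.rel (tensor (id [c]) (cup h) :)
      (comp (tensor (cup h) (id [c]) :)
        (comp (tensor (id [a]) (cross o b c) :) (tensor (cross o a c) (id [b]) :)))

variable {A : DiagramAction E} {s t : List Orientation} {a b c : Orientation}

namespace IsBraided

theorem cross_cross (hA : A.IsBraided) (o : Bool) (a b : Orientation) (p u : List Orientation)
    (x : E) : A.slice p (cross (!o) b a) u (A.slice p (cross o a b) u x) =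
      A.unit (p ++ a :: b :: u) x := by
  rw [← slice_comp, A.slice_congr (hA.reidemeister_two o a b), slice_id]
  simp

theorem cross_cross_not (hA : A.IsBraided) (o : Bool) (a b : Orientation)
    (p u : List Orientation) (x : E) :
    A.slice p (cross o b a) u (A.slice p (cross (!o) a b) u x) = A.unit (p ++ a :: b :: u) x := by
  simpa using hA.cross_cross (!o) a b p u x

theorem cap_cup_left (hA : A.IsBraided) (h : a ≠ b) (p u : List Orientation) (x : E) :
    A.slice p (cap h) (a :: u) (A.slice (p ++ [a]) (cup h.symm) u x) = A.unit (p ++ a :: u) x := by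
  have := A.slice_congr (hA.zigzag_left h) p u x
  rw [slice_comp, slice_tensor_left, slice_tensor_right, slice_id] at this
  simpa using this

theorem cap_cup_right (hA : A.IsBraided) (h : a ≠ b) (p u : List Orientation) (x : E) :
    A.slice (p ++ [a]) (cap h.symm) u (A.slice p (cup h) (a :: u) x) = A.unit (p ++ a :: u) x := by
  have := A.slice_congr (hA.zigzag_right h) p u x
  rw [slice_comp, slice_tensor_left, slice_tensor_right, slice_id] at this
  simpa using this

/-- Half of the passage of a strand across a maximum: the strand crosses the other leg of the
maximum, with the same side on top. -/
theorem cap_cross (hA : A.IsBraided) (o : Bool) (h : a ≠ b) (c : Orientation)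
    (p u : List Orientation) (x : E) :
    A.slice p (cap h) (c :: u) (A.slice (p ++ [a]) (cross (!o) c b) u x) =
      A.slice (p ++ [c]) (cap h) u (A.slice p (cross o a c) (b :: u) x) := by
  have := A.slice_congr (hA.slide_cap o h c) p u (A.slice (p ++ [a]) (cross (!o) c b) u x)
  simp only [slice_comp, slice_tensor_left, slice_tensor_right, List.cons_append,
    List.nil_append, hA.cross_cross_not] at this
  rw [this, slice_unit _ _ _ _ _ (by simp)]

/-- Half of the passage of a strand across a minimum. -/
theorem cross_cup (hA : A.IsBraided) (o : Bool) (h : a ≠ b) (c : Orientation)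
    (p u : List Orientation) (x : E) :
    A.slice p (cross (!o) c a) (b :: u) (A.slice (p ++ [c]) (cup h) u x) =
      A.slice (p ++ [a]) (cross o b c) u (A.slice p (cup h) (c :: u) x) := by
  have := A.slice_congr (hA.slide_cup o h c) p u x
  simp only [slice_comp, slice_tensor_left, slice_tensor_right, List.cons_append,
    List.nil_append] at this
  rw [this, hA.cross_cross, unit_slice _ _ _ _ _ (by simp)]

/-- A crossing is obtained from the opposite crossing by reversing the strand that is first at the
bottom. -/
theorem cross_eq_rotate_right (hA : A.IsBraided) (o : Bool) (h : a ≠ b) (c : Orientation)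
    (p u : List Orientation) (x : E) :
    A.slice p (cross o b c) u x =
      A.slice p (cap h.symm) (c :: b :: u) (A.slice (p ++ [b]) (cross (!o) c a) (b :: u)
        (A.slice (p ++ [b, c]) (cup h) u x)) := by
  have h1 := A.slice_comm p [] u (cross o b c) (cup h) x
  have h2 := hA.cap_cup_left h.symm (p ++ [c]) u (A.slice p (cross o b c) u x)
  simp only [List.cons_append, List.nil_append, List.append_nil, List.append_assoc] at h1 h2
  rw [hA.cap_cross, ← h1, h2, unit_slice _ _ _ _ _ (by simp)]

/-- A crossing is obtained from the opposite crossing by reversing the strand that is second at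
the bottom. -/
theorem cross_eq_rotate_left (hA : A.IsBraided) (o : Bool) (h : a ≠ b) (c : Orientation)
    (p u : List Orientation) (x : E) :
    A.slice p (cross o c b) u x =
      A.slice (p ++ [b, c]) (cap h) u (A.slice (p ++ [b]) (cross (!o) a c) (b :: u)
        (A.slice p (cup h.symm) (c :: b :: u) x)) := by
  have h0 := hA.cross_cup (!o) h.symm c p (b :: u) x
  have h1 := A.slice_comm p [] u (cross o c b) (cap h)
    (A.slice (p ++ [c]) (cup h.symm) (b :: u) x)
  have h2 := hA.cap_cup_right h.symm (p ++ [c]) u x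
  simp only [List.cons_append, List.nil_append, List.append_nil, List.append_assoc,
    Bool.not_not] at h0 h1 h2
  rw [← h0, h1, h2, slice_unit _ _ _ _ _ (by simp)]

end IsBraided

/-! ### Moving a strand across a tangle -/

variable (A) in
/-- A strand `b` moves from the left of the strands `v` to their right, passing over all of them
if `o = true` and under all of them if `o = false`. -/
def slide (o : Bool) (b : Orientation) :
    List Orientation → List Orientation → List Orientation → E → E
  | _, [], _, x => x
  | p, c :: v, u, x => slide o b (p ++ [c]) v u (A.slice p (cross o b c) (v ++ u) x)

theorem slide_append (o : Bool) (b : Orientation) (p v w u : List Orientation) (x : E) :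
    A.slide o b p (v ++ w) u x = A.slide o b (p ++ v) w u (A.slide o b p v (w ++ u) x) := by
  induction v generalizing p x with
  | nil => simp [slide]
  | cons c v ih => simp [slide, ih]

theorem slice_slide_right (o : Bool) (b : Orientation) (p v m u : List Orientation)
    (K : Diagram s t) (x : E) :
    A.slice (p ++ v ++ [b] ++ m) K u (A.slide o b p v (m ++ s ++ u) x) =
      A.slide o b p v (m ++ t ++ u) (A.slice (p ++ [b] ++ v ++ m) K u x) := by
  induction v generalizing p x with
  | nil => simp [slide]
  | cons c v ih =>
    have h1 := A.slice_comm p (v ++ m) u (cross o b c) K x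
    have h2 := ih (p ++ [c]) (A.slice p (cross o b c) (v ++ m ++ s ++ u) x)
    simp only [List.cons_append, List.nil_append, List.append_assoc, slide] at h1 h2 ⊢
    rw [h2, h1]

theorem slice_slide_left (o : Bool) (b : Orientation) (p v m u : List Orientation)
    (K : Diagram s t) (x : E) :
    A.slice p K (m ++ v ++ [b] ++ u) (A.slide o b (p ++ s ++ m) v u x) =
      A.slide o b (p ++ t ++ m) v u (A.slice p K (m ++ [b] ++ v ++ u) x) := by
  induction v generalizing m x with
  | nil => simp [slide]
  | cons c v ih =>
    have h1 := A.slice_comm p m (v ++ u) K (cross o b c) x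
    have h2 := ih (m ++ [c]) (A.slice (p ++ s ++ m) (cross o b c) (v ++ u) x)
    simp only [List.cons_append, List.nil_append, List.append_assoc, slide] at h1 h2 ⊢
    rw [h2, h1]

variable (A) in
/-- The diagram `K` can be pulled through a strand `b` that passes over (`o = true`) or under
(`o = false`) everything. -/
def Slides (o : Bool) (b : Orientation) (K : Diagram s t) : Prop :=
  ∀ (p u : List Orientation) (x : E), A.slice p K (b :: u) (A.slide o b p s u x) =
    A.slide o b p t u (A.slice (p ++ [b]) K u x)

namespace Slides
variable {o : Bool}

theorem comp {w : List Orientation} {f : Diagram s t} {g : Diagram t w} (hf : A.Slides o b f)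
    (hg : A.Slides o b g) : A.Slides o b (.comp f g) := by
  intro p u x
  rw [slice_comp, slice_comp, hf, hg]

theorem tensor_left {K : Diagram s t} (hK : A.Slides o b K) (y : List Orientation) :
    A.Slides o b (.tensor (.id y) K) := by
  intro p u x
  have h := A.slice_slide_right o b p y [] u K x
  simp only [List.cons_append, List.nil_append, List.append_nil, List.append_assoc] at h
  rw [slice_tensor_left, slice_tensor_left, slide_append, slide_append, hK, List.append_assoc,
    List.append_assoc, List.singleton_append, h]

theorem tensor_right {K : Diagram s t} (hK : A.Slides o b K) (y : List Orientation) :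
    A.Slides o b (.tensor K (.id y)) := by
  intro p u x
  have h := A.slice_slide_left o b p y [] u K (A.slide o b p s (y ++ u) x)
  simp only [List.cons_append, List.nil_append, List.append_nil, List.append_assoc] at h
  rw [slice_tensor_right, slice_tensor_right, slide_append, slide_append, h, hK]

theorem of_slice_eq {K K' : Diagram s t} (hK : A.Slides o b K)
    (h : ∀ p u x, A.slice p K' u x = A.slice p K u x) : A.Slides o b K' := by
  intro p u x
  rw [h, h, hK]

theorem cap (hA : A.IsBraided) (o : Bool) (c : Orientation) (h : a ≠ b) :
    A.Slides o c (cap h) := by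
  intro p u x
  have := A.slice_congr (hA.slide_cap (!o) h c) p u (A.slide o c p [a, b] u x)
  simp only [slice_comp, slice_tensor_left, slice_tensor_right, slide, List.cons_append,
    List.nil_append, hA.cross_cross] at this ⊢
  rw [this, slice_unit _ _ _ _ _ (by simp), hA.cross_cross, slice_unit _ _ _ _ _ (by simp)]

theorem cup (hA : A.IsBraided) (o : Bool) (c : Orientation) (h : a ≠ b) :
    A.Slides o c (cup h) := by
  intro p u x
  have := A.slice_congr (hA.slide_cup (!o) h c) p u x
  simp only [slice_comp, slice_tensor_left, slice_tensor_right, slide, List.cons_append,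
    List.nil_append] at this ⊢
  rw [this, hA.cross_cross_not, slice_unit _ _ _ _ _ (by simp), hA.cross_cross_not,
    unit_slice _ _ _ _ _ (by simp)]

/-- If a crossing can be pulled through a strand, so can its inverse. -/
theorem cross_inv (hA : A.IsBraided) {o' : Bool} {a c : Orientation}
    (h : A.Slides o b (cross o' a c)) : A.Slides o b (cross (!o') c a) := by
  intro p u x
  have h1 := h p u (A.slice (p ++ [b]) (cross (!o') c a) u x)
  rw [hA.cross_cross_not] at h1
  have h2 : A.slide o b p [c, a] u (A.unit (p ++ [b] ++ c :: a :: u) x) =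
      A.slide o b p [c, a] u x := by
    simp only [slide]
    rw [slice_unit _ _ _ _ _ (by simp)]
  rw [← h2, ← h1, hA.cross_cross]
  simp only [slide]
  rw [unit_slice _ _ _ _ _ (by simp)]

/-- If a crossing can be pulled through a strand, so can its rotation by a quarter turn. -/
theorem cross_rotate (hA : A.IsBraided) {o' : Bool} {a c d : Orientation} (hd : a ≠ d)
    (h : A.Slides o b (cross (!o') c a)) : A.Slides o b (cross o' d c) := by
  have h1 : A.Slides o b (Diagram.comp (tensor (id [d, c]) (Diagram.cup hd) :)
      (Diagram.comp (tensor (id [d]) (tensor (cross (!o') c a) (id [d]) :) :)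
        (tensor (Diagram.cap hd.symm) (id [c, d]) :)) : Diagram [d, c] [c, d]) :=
    comp ((cup hA o b hd).tensor_left [d, c])
      (comp ((h.tensor_right [d]).tensor_left [d]) ((cap hA o b hd.symm).tensor_right [c, d]))
  refine h1.of_slice_eq fun p u x => ?_
  rw [hA.cross_eq_rotate_right o' hd c]
  simp only [slice_comp, slice_tensor_left, slice_tensor_right, List.cons_append,
    List.nil_append]

/-- If the crossings of two upward strands can be pulled through a strand, so can the crossings
with any orientations. -/
theorem cross_of_up (hA : A.IsBraided)
    (h : ∀ o', A.Slides o b (cross o' .up .up)) (o' : Bool) (c d : Orientation) :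
    A.Slides o b (cross o' c d) := by
  have h1 : ∀ o', A.Slides o b (cross o' .down .up) :=
    fun o' => cross_rotate hA (a := .up) (by simp) (h _)
  have h2 : ∀ o', A.Slides o b (cross o' .down .down) :=
    fun o' => cross_rotate hA (a := .up) (by simp) (h1 _)
  have h3 : ∀ o', A.Slides o b (cross o' .up .down) :=
    fun o' => cross_rotate hA (a := .down) (by simp) (h2 _)
  cases c <;> cases d
  exacts [h o', h3 o', h1 o', h2 o']

/-- The third Reidemeister move, read as pulling a crossing through its first strand, can also be
read as pulling a crossing through its last strand. -/
theorem last_of_first (hA : A.IsBraided) {a c d : Orientation} (h : A.Slides o a (cross o c d)) :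
    A.Slides (!o) d (cross o a c) := by
  intro p u x
  have h1 := h p u (A.slide (!o) d p [a, c] u x)
  simp only [slide, List.append_assoc, List.cons_append, List.nil_append,
    hA.cross_cross_not] at h1 ⊢
  rw [slice_unit _ _ _ _ _ (by simp), hA.cross_cross_not, slice_unit _ _ _ _ _ (by simp)] at h1
  rw [← h1, hA.cross_cross, slice_unit _ _ _ _ _ (by simp), hA.cross_cross,
    unit_slice _ _ _ _ _ (by simp)]

/-- The third Reidemeister move for three upward strands implies the one for all orientations. -/
theorem cross_of_all_up (hA : A.IsBraided)
    (h : ∀ o, A.Slides o .up (cross o .up .up)) (o o' : Bool) (a c d : Orientation) :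
    A.Slides o a (cross o' c d) := by
  have key : ∀ a, (∀ o, A.Slides o a (cross o .up .up)) →
      ∀ o o' c d, A.Slides o a (cross o' c d) := by
    intro a ha o
    refine cross_of_up hA fun o' => ?_
    rcases eq_or_ne o' o with rfl | ho
    · exact ha o'
    · have := cross_inv hA (ha o)
      rwa [← Bool.eq_not_of_ne ho] at this
  have h2 : ∀ o a, A.Slides o a (cross (!o) .up .up) := fun o a => by
    simpa using last_of_first hA (key .up h (!o) (!o) .up a)
  refine key a (fun o => ?_) o o' c d
  simpa using cross_inv hA (h2 o a)

end Slides
end DiagramAction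
end Homfly

namespace Homfly
open Homfly.Diagram Homfly.Orientation

/-! ### Tangles acting on the Brauer category -/

theorem Diagram.Isotopic.endpoints {s t s' t' : List Orientation} {f : Diagram s t}
    {g : Diagram s' t'} (h : Isotopic f g) : s = s' ∧ t = t' := by
  induction h <;> simp_all

theorem isotopic_monoidalCongruence : MonoidalCongruence @Isotopic where
  refl := .refl
  symm := .symm
  trans := .trans
  comp_congr := .comp_congr
  tensor_congr := .tensor_congr
  id_comp := .id_comp
  comp_id := .comp_id
  comp_assoc := .comp_assoc
  tensor_id := .tensor_id
  tensor_comp := .tensor_comp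
  unit_tensor := .unit_tensor
  tensor_unit := .tensor_unit
  tensor_assoc := .tensor_assoc

namespace Tangle
variable {s t u v : List Orientation}

theorem comp_assoc (f : Tangle s t) (g : Tangle t u) (h : Tangle u v) :
    comp (comp f g) h = comp f (comp g h) := by
  induction f using Quotient.ind
  induction g using Quotient.ind
  induction h using Quotient.ind
  exact Quotient.sound (.comp_assoc _ _ _)

theorem comp_id (f : Tangle s t) : comp f (id t) = f := by
  induction f using Quotient.ind
  exact Quotient.sound (.comp_id _)

theorem id_comp (f : Tangle s t) : comp (id s) f = f := by
  induction f using Quotient.ind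
  exact Quotient.sound (.id_comp _)

end Tangle

variable {s t : List Orientation}

/-- Stacking the tangle `K` on top of the morphisms of `Br(β)` out of the empty sequence. -/
noncomputable def stackBr (K : Tangle s t) : BrHom [] s →ₗ[BaseRing] BrHom [] t :=
  Submodule.mapQ _ _ (Finsupp.lmapDomain BaseRing BaseRing fun T => Tangle.comp T K) <| by
    rw [relatorIdeal, Submodule.span_le]
    rintro _ ⟨x, y, u, v, f, g, r, hr, rfl⟩
    refine Submodule.subset_span ⟨x, y, u, v, f, Tangle.comp g K, r, hr, ?_⟩
    simp only [plug, Finsupp.lmapDomain_apply]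
    rw [← Finsupp.mapDomain_comp]
    congr 1
    funext T
    simp [Tangle.comp_assoc]

theorem stackBr_quotientFunctor (K : Tangle s t) (T : Tangle [] s) :
    stackBr K (quotientFunctor T) = quotientFunctor (Tangle.comp T K) := by
  simp [stackBr, quotientFunctor, Submodule.mapQ_apply, Finsupp.mapDomain_single]

theorem stackBr_ext {M : Type*} [AddCommGroup M] [Module BaseRing M]
    {f g : BrHom [] s →ₗ[BaseRing] M}
    (h : ∀ T, f (quotientFunctor T) = g (quotientFunctor T)) : f = g := by
  refine Submodule.linearMap_qext _ (Finsupp.lhom_ext' fun T => LinearMap.ext_ring ?_)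
  exact h T

/-- The product of all morphism spaces of `Br(β)` out of the empty sequence. -/
abbrev BrSpace : Type := ∀ s : List Orientation, BrHom [] s

open Classical in
/-- A tangle `s → t` maps the factor of `s` to the factor of `t` by stacking and kills the other
factors. -/
noncomputable def tangleAct (K : Tangle s t) : BrSpace →ₗ[BaseRing] BrSpace :=
  (LinearMap.single BaseRing (fun s => BrHom [] s) t) ∘ₗ stackBr K ∘ₗ LinearMap.proj s

theorem tangleAct_comp {u : List Orientation} (f : Tangle s t) (g : Tangle t u) (x : BrSpace) :
    tangleAct (Tangle.comp f g) x = tangleAct g (tangleAct f x) := by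
  have : stackBr (Tangle.comp f g) = stackBr g ∘ₗ stackBr f :=
    stackBr_ext fun T => by simp [stackBr_quotientFunctor, Tangle.comp_assoc]
  simp [tangleAct, this]

/-- The action of diagrams on the morphism spaces of `Br(β)`. -/
noncomputable def brAction : DiagramAction BrSpace where
  rel := Isotopic
  act K := tangleAct (Tangle.mk K)
  isCongr := isotopic_monoidalCongruence
  act_congr h := by
    obtain ⟨rfl, rfl⟩ := h.endpoints
    congr 2
    exact Quotient.sound h
  act_comp f g x := tangleAct_comp (Tangle.mk f) (Tangle.mk g) x

theorem brAction_isBraided : brAction.IsBraided where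
  zigzag_left := .zigzag_left
  zigzag_right := .zigzag_right
  reidemeister_two := .reidemeister_two
  slide_cap := .slide_cap
  slide_cup := .slide_cup

theorem brAction_slides (o o' : Bool) (a b c : Orientation) :
    brAction.Slides o a (cross o' b c) := by
  refine DiagramAction.Slides.cross_of_all_up brAction_isBraided (fun o p u x => ?_) o o' a b c
  have := brAction.slice_congr (Isotopic.reidemeister_three o up up up) p u x
  simpa only [DiagramAction.slice_comp, DiagramAction.slice_tensor_left,
    DiagramAction.slice_tensor_right, DiagramAction.slide, List.cons_append, List.nil_append,
    List.append_assoc] using this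

theorem isLinearMap_slice (p : List Orientation) (K : Diagram s t) (u : List Orientation) :
    IsLinearMap BaseRing (brAction.slice p K u) :=
  (tangleAct (Tangle.mk (whisker p K u))).isLinear

/-- The action on `x` of a formal linear combination of tangles, with vertical strands `p` on the
left and `u` on the right. -/
noncomputable def linAct (p u : List Orientation) (x : BrSpace) :
    LinTangle s t →ₗ[BaseRing] BrSpace :=
  Finsupp.linearCombination BaseRing fun T =>
    tangleAct (Tangle.tensor (Tangle.tensor (Tangle.id p) T) (Tangle.id u)) x

theorem linAct_diag (p u : List Orientation) (x : BrSpace) (K : Diagram s t) :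
    linAct p u x (diag K) = brAction.slice p K u x := by
  simp only [linAct, diag, Finsupp.linearCombination_single, one_smul]
  rfl

theorem linAct_relator (p u : List Orientation) (x : BrSpace) {r : LinTangle s t}
    (hr : Relator s t r) : linAct p u x r = 0 := by
  classical
  let F : LinTangle s t →ₗ[BaseRing]
      (BrHom [] (p ++ s ++ u) →ₗ[BaseRing] BrHom [] (p ++ t ++ u)) :=
    Finsupp.linearCombination BaseRing fun T =>
      stackBr (Tangle.tensor (Tangle.tensor (Tangle.id p) T) (Tangle.id u))
  have h1 : ∀ r, linAct p u x r =
      LinearMap.single BaseRing (fun s => BrHom [] s) (p ++ t ++ u) (F r (x (p ++ s ++ u))) := by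
    intro r
    induction r using Finsupp.induction_linear with
    | zero => simp
    | add r r' h h' => simp only [map_add, LinearMap.add_apply, h, h']
    | single T c =>
      simp only [linAct, F, Finsupp.linearCombination_single, LinearMap.smul_apply, map_smul]
      rfl
  have h2 : ∀ (r : LinTangle s t) T, F r (quotientFunctor T) =
      (relatorIdeal _ _).mkQ (plug p u T (Tangle.id _) r) := by
    intro r T
    induction r using Finsupp.induction_linear with
    | zero => simp
    | add r r' h h' => simp only [map_add, LinearMap.add_apply, h, h']
    | single T' c =>
      simp only [F, Finsupp.linearCombination_single, LinearMap.smul_apply,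
        stackBr_quotientFunctor, plug, Finsupp.lmapDomain_apply, Finsupp.mapDomain_single,
        Tangle.comp_id]
      rw [quotientFunctor, ← map_smul, Finsupp.smul_single, smul_eq_mul, mul_one]
  have h3 : F r = 0 := stackBr_ext fun T => by
    rw [h2]
    exact (Submodule.Quotient.mk_eq_zero _).2
      (Submodule.subset_span ⟨_, _, p, u, T, Tangle.id _, r, hr, rfl⟩)
  rw [h1, h3]
  simp

theorem linAct_eq_of_relator (p u : List Orientation) (x : BrSpace) {z z' : LinTangle s t}
    (h : Relator s t (z - z')) : linAct p u x z = linAct p u x z' := by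
  rw [← sub_add_cancel z z', map_add, linAct_relator p u x h]
  exact zero_add (linAct p u x z')

end Homfly

namespace Homfly
open Homfly.Diagram Homfly.Orientation

/-! ### Skein relations for all orientations -/

namespace DiagramAction

variable {k W : Type*} [CommRing k] [AddCommGroup W] [Module k W]

variable (k) in
/-- A linear action of diagrams that satisfies the moves of tangles and, for some scalars, the
skein relation for two upward strands and the relations that remove a circle or a curl of an upward
strand. -/
structure IsSkein (A : DiagramAction W) : Prop extends A.IsBraided where
  isLinear {s t : List Orientation} (p : List Orientation) (K : Diagram s t)
    (u : List Orientation) : IsLinearMap k (A.slice p K u)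
  cross_slides (o o' : Bool) (a b c : Orientation) : A.Slides o a (cross o' b c)
  skein_up : ∃ z : k, ∀ p u x, A.slice p (cross true up up) u x =
    A.slice p (cross false up up) u x + z • A.unit (p ++ up :: up :: u) x
  circle {a b : Orientation} (h : a ≠ b) : ∃ c : k, ∀ p u x,
    A.slice p (cap h) u (A.slice p (cup h) u x) = c • A.unit (p ++ u) x
  curl_right (o : Bool) (h : up ≠ down) : ∃ c : k, ∀ p u x,
    A.slice (p ++ [up]) (cap h) u (A.slice p (cross o up up) (down :: u)
      (A.slice (p ++ [up]) (cup h) u x)) = c • A.unit (p ++ up :: u) x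
  curl_left (o : Bool) (h : down ≠ up) : ∃ c : k, ∀ p u x,
    A.slice p (cap h) (up :: u) (A.slice (p ++ [down]) (cross o up up) u
      (A.slice p (cup h) (up :: u) x)) = c • A.unit (p ++ up :: u) x

namespace IsSkein

variable {A : DiagramAction W} (hA : A.IsSkein k) {a b : Orientation}
include hA

theorem slice_add {s t : List Orientation} (p : List Orientation) (K : Diagram s t)
    (u : List Orientation) (x y : W) :
    A.slice p K u (x + y) = A.slice p K u x + A.slice p K u y :=
  (hA.isLinear p K u).map_add x y

theorem slice_smul {s t : List Orientation} (p : List Orientation) (K : Diagram s t)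
    (u : List Orientation) (c : k) (x : W) : A.slice p K u (c • x) = c • A.slice p K u x :=
  (hA.isLinear p K u).map_smul c x

theorem skein_antiparallel (h : a ≠ b) (z : k)
    (ha : ∀ p u x, A.slice p (cross true a a) u x =
      A.slice p (cross false a a) u x + z • A.unit (p ++ a :: a :: u) x)
    (p u : List Orientation) (x : W) :
    A.slice p (cross true b a) u x = A.slice p (cross false b a) u x +
      -z • A.slice p (cup h) u (A.slice p (cap h.symm) u x) := by
  have h1 := A.slice_comm p [] u (cap h.symm) (cup h) x
  simp only [List.cons_append, List.nil_append, List.append_nil] at h1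
  rw [hA.cross_eq_rotate_right _ h, hA.cross_eq_rotate_right _ h]
  simp only [Bool.not_true, Bool.not_false]
  rw [ha, hA.slice_add, hA.slice_smul, slice_unit _ _ _ _ _ (by simp), h1, neg_smul,
    add_neg_cancel_right]

theorem skein_parallel (h : a ≠ b) (z : k)
    (ha : ∀ p u x, A.slice p (cross true b a) u x = A.slice p (cross false b a) u x +
      z • A.slice p (cup h) u (A.slice p (cap h.symm) u x))
    (p u : List Orientation) (x : W) :
    A.slice p (cross true b b) u x =
      A.slice p (cross false b b) u x + -z • A.unit (p ++ b :: b :: u) x := by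
  have h1 := hA.cap_cup_left h.symm (p ++ [b]) u x
  simp only [List.append_assoc, List.cons_append, List.nil_append] at h1
  rw [hA.cross_eq_rotate_right true h, hA.cross_eq_rotate_right false h]
  simp only [Bool.not_true, Bool.not_false]
  rw [ha, hA.slice_add, hA.slice_smul, h1, hA.cap_cup_left h.symm, unit_unit, neg_smul,
    add_neg_cancel_right]

theorem exists_skein_same (a : Orientation) : ∃ z : k, ∀ p u x,
    A.slice p (cross true a a) u x =
      A.slice p (cross false a a) u x + z • A.unit (p ++ a :: a :: u) x := by
  obtain ⟨z, hz⟩ := hA.skein_up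
  cases a
  · exact ⟨z, hz⟩
  · have h : up ≠ down := by simp
    exact ⟨_, hA.skein_parallel h _ (hA.skein_antiparallel h z hz)⟩

theorem exists_skein_opposite (h : a ≠ b) : ∃ z : k, ∀ p u x,
    A.slice p (cross true b a) u x = A.slice p (cross false b a) u x +
      z • A.slice p (cup h) u (A.slice p (cap h.symm) u x) := by
  obtain ⟨z, hz⟩ := hA.exists_skein_same a
  exact ⟨_, hA.skein_antiparallel h z hz⟩

/-- A crossing on top of a minimum can be removed. -/
theorem exists_cross_cup (o : Bool) (h : a ≠ b) : ∃ c : k, ∀ p u x,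
    A.slice p (cross o a b) u (A.slice p (cup h) u x) = c • A.slice p (cup h.symm) u x := by
  cases a <;> cases b <;> try exact absurd rfl h
  · obtain ⟨c, hc⟩ := hA.curl_right (!o) h
    refine ⟨c, fun p u x => ?_⟩
    have h1 := A.slice_comm p [] u (cup h.symm) (cup h) x
    have h2 := hc (p ++ [down]) u (A.slice p (cup h.symm) u x)
    simp only [List.append_assoc, List.cons_append, List.nil_append, List.append_nil] at h1 h2
    rw [hA.cross_eq_rotate_left o h, ← h1, h2, unit_slice _ _ _ _ _ (by simp)]
  · obtain ⟨c, hc⟩ := hA.curl_left (!o) h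
    refine ⟨c, fun p u x => ?_⟩
    have h1 := A.slice_comm p [] u (cup h) (cup h.symm) x
    have h2 := hc p (down :: u) (A.slice p (cup h.symm) u x)
    simp only [List.cons_append, List.nil_append, List.append_nil] at h1 h2
    rw [hA.cross_eq_rotate_right o h.symm, h1, h2, unit_slice _ _ _ _ _ (by simp)]

/-- A crossing below a maximum can be removed. -/
theorem exists_cap_cross (o : Bool) (h : a ≠ b) : ∃ c : k, ∀ p u x,
    A.slice p (cap h) u (A.slice p (cross o b a) u x) = c • A.slice p (cap h.symm) u x := by
  cases a <;> cases b <;> try exact absurd rfl h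
  · obtain ⟨c, hc⟩ := hA.curl_right (!o) h
    refine ⟨c, fun p u x => ?_⟩
    have h1 := A.slice_comm p [] u (cap h.symm) (cap h)
      (A.slice (p ++ [down]) (cross (!o) up up) (down :: u)
        (A.slice (p ++ [down, up]) (cup h) u x))
    have h2 := hc (p ++ [down]) u x
    simp only [List.append_assoc, List.cons_append, List.nil_append, List.append_nil] at h1 h2
    rw [hA.cross_eq_rotate_right o h, h1, h2, hA.slice_smul, slice_unit _ _ _ _ _ (by simp)]
  · obtain ⟨c, hc⟩ := hA.curl_left (!o) h
    refine ⟨c, fun p u x => ?_⟩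
    have h1 := A.slice_comm p [] u (cap h) (cap h.symm)
      (A.slice (p ++ [down]) (cross (!o) up up) (down :: u)
        (A.slice p (cup h) (up :: down :: u) x))
    have h2 := hc p (down :: u) x
    simp only [List.cons_append, List.nil_append, List.append_nil] at h1 h2
    rw [hA.cross_eq_rotate_left o h.symm, ← h1, h2, hA.slice_smul, slice_unit _ _ _ _ _ (by simp)]

end IsSkein
end DiagramAction
end Homfly

namespace Homfly
open Homfly.Diagram Homfly.Orientation

namespace DiagramAction

/-! ### Arcs -/

section Arc

variable {E : Type*} (A : DiagramAction E) {a b : Orientation}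

/-- A minimum with left endpoint `a` and right endpoint `b` is added, the strands `u`, `v` and `w`
being to its left, between its endpoints and to its right; it passes over the strands `v`. -/
def arc (h : a ≠ b) (u v w : List Orientation) (x : E) : E :=
  A.slide true b (u ++ [a]) v w (A.slice u (cup h) (v ++ w) x)

variable {A}

theorem arc_cons (hA : A.IsBraided) (h : a ≠ b) (c : Orientation) (u v w : List Orientation)
    (x : E) : A.arc h u (c :: v) w x =
      A.slice u (cross false c a) (v ++ b :: w) (A.arc h (u ++ [c]) v w x) := by
  have h1 := hA.cross_cup true h c u (v ++ w) x
  have h2 := A.slice_slide_left true b u v [] w (cross false c a)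
    (A.slice (u ++ [c]) (cup h) (v ++ w) x)
  simp only [List.append_assoc, List.cons_append, List.nil_append, arc, slide,
    Bool.not_true] at h1 h2 ⊢
  rw [h2, ← h1]

theorem arc_concat (h : a ≠ b) (c : Orientation) (u v w : List Orientation) (x : E) :
    A.arc h u (v ++ [c]) w x =
      A.slice (u ++ a :: v) (cross true b c) w (A.arc h u v (c :: w) x) := by
  simp [arc, slide_append, slide]

variable {s t : List Orientation} (K : Diagram s t)

theorem slice_arc_left (h : a ≠ b) (p m v w : List Orientation) (x : E) :
    A.slice p K (m ++ a :: (v ++ b :: w)) (A.arc h (p ++ s ++ m) v w x) =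
      A.arc h (p ++ t ++ m) v w (A.slice p K (m ++ (v ++ w)) x) := by
  have h1 := A.slice_slide_left true b p v (m ++ [a]) w K
    (A.slice (p ++ s ++ m) (cup h) (v ++ w) x)
  have h2 := A.slice_comm p m (v ++ w) K (cup h) x
  simp only [List.append_assoc, List.cons_append, List.nil_append, arc] at h1 h2 ⊢
  rw [h1, h2]

theorem slice_arc_right (h : a ≠ b) (u v m r : List Orientation) (x : E) :
    A.slice (u ++ a :: (v ++ b :: m)) K r (A.arc h u v (m ++ s ++ r) x) =
      A.arc h u v (m ++ t ++ r) (A.slice (u ++ (v ++ m)) K r x) := by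
  have h1 := A.slice_slide_right true b (u ++ [a]) v m r K
    (A.slice u (cup h) (v ++ m ++ s ++ r) x)
  have h2 := A.slice_comm u (v ++ m) r (cup h) K x
  simp only [List.append_assoc, List.cons_append, List.nil_append, arc] at h1 h2 ⊢
  rw [h1, h2]

variable {K} in
theorem slice_arc_between (h : a ≠ b) (hK : A.Slides true b K) (u m m' w : List Orientation)
    (x : E) : A.slice (u ++ a :: m) K (m' ++ b :: w) (A.arc h u (m ++ s ++ m') w x) =
      A.arc h u (m ++ t ++ m') w (A.slice (u ++ m) K (m' ++ w) x) := by
  have h1 := (hK.tensor_right m').tensor_left m (u ++ [a]) w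
    (A.slice u (cup h) (m ++ s ++ m' ++ w) x)
  have h2 := A.slice_comm u m (m' ++ w) (cup h) K x
  simp only [List.append_assoc, List.cons_append, List.nil_append, arc, slice_tensor_left,
    slice_tensor_right] at h1 h2 ⊢
  rw [h1, h2]

end Arc

/-! ### The span of the descending diagrams -/

theorem _root_.Homfly.Orientation.eq_of_ne {a b c : Orientation} (ha : a ≠ c) (hb : b ≠ c) :
    a = b := by
  cases a <;> cases b <;> cases c <;> simp_all

/-- The four relative positions of a pair of neighbours and a marked entry of a list. -/
theorem append_pair_eq_append {p r u z : List Orientation} {c d a : Orientation}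
    (h : p ++ c :: d :: r = u ++ a :: z) :
    (∃ r', u = p ++ c :: d :: r' ∧ r = r' ++ a :: z) ∨ (u = p ++ [c] ∧ d = a ∧ r = z) ∨
      (p = u ∧ c = a ∧ z = d :: r) ∨ (∃ p', p = u ++ a :: p' ∧ z = p' ++ c :: d :: r) := by
  rcases List.append_eq_append_iff.1 h with ⟨l, h1, h2⟩ | ⟨l, h1, h2⟩
  · rcases l with _ | ⟨e, _ | ⟨e', l⟩⟩ <;> simp_all
  · rcases l with _ | ⟨e, l⟩ <;> simp_all

variable {k W : Type*} [CommRing k] [AddCommGroup W] [Module k W]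

/-- The results of adding arcs to `x₀`, each on top of all the previous ones; the list records the
endpoints. -/
inductive Descending (A : DiagramAction W) (x₀ : W) : List Orientation → W → Prop
  | nil : Descending A x₀ [] x₀
  | arc {a b : Orientation} (h : a ≠ b) (u v w : List Orientation) {x : W} :
      Descending A x₀ (u ++ (v ++ w)) x →
        Descending A x₀ (u ++ a :: (v ++ b :: w)) (A.arc h u v w x)

variable (k) in
/-- The span of the descending elements with endpoints `l`. -/
def descSpan (A : DiagramAction W) (x₀ : W) (l : List Orientation) : Submodule k W :=
  Submodule.span k {x | Descending A x₀ l x}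

namespace IsSkein

variable {A : DiagramAction W} (hA : A.IsSkein k) {x₀ : W} {a b : Orientation}
  {l : List Orientation}
include hA

theorem isLinearMap_slide (o : Bool) (b : Orientation) (p v u : List Orientation) :
    IsLinearMap k (A.slide o b p v u) := by
  induction v generalizing p with
  | nil => exact IsLinearMap.mk (fun _ _ => rfl) fun _ _ => rfl
  | cons c v ih =>
    exact (((ih (p ++ [c])).mk' _).comp ((hA.isLinear p (cross o b c) (v ++ u)).mk' _)).isLinear

theorem isLinearMap_arc (h : a ≠ b) (u v w : List Orientation) :
    IsLinearMap k (A.arc h u v w) :=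
  (((hA.isLinearMap_slide true b (u ++ [a]) v w).mk' _).comp
    ((hA.isLinear u (cup h) (v ++ w)).mk' _)).isLinear

omit hA in
theorem mem_of_descending {f : W → W} (hf : IsLinearMap k f) {N : Submodule k W}
    (h : ∀ x, Descending A x₀ l x → f x ∈ N) {x : W} (hx : x ∈ descSpan k A x₀ l) :
    f x ∈ N := by
  have : descSpan k A x₀ l ≤ N.comap (hf.mk' f) := Submodule.span_le.2 h
  exact this hx

theorem arc_mem (h : a ≠ b) (u v w : List Orientation) {x : W}
    (hx : x ∈ descSpan k A x₀ (u ++ (v ++ w))) :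
    A.arc h u v w x ∈ descSpan k A x₀ (u ++ a :: (v ++ b :: w)) :=
  mem_of_descending (hA.isLinearMap_arc h u v w)
    (fun _ hx => Submodule.subset_span (.arc h u v w hx)) hx

theorem cup_mem (h : a ≠ b) (u w : List Orientation) {x : W}
    (hx : x ∈ descSpan k A x₀ (u ++ w)) :
    A.slice u (cup h) w x ∈ descSpan k A x₀ (u ++ a :: b :: w) :=
  hA.arc_mem h u [] w hx

omit [CommRing k] [AddCommGroup W] [Module k W] hA in
theorem unit_arc (h : a ≠ b) (u v w : List Orientation) (x : W) :
    A.unit (u ++ a :: (v ++ b :: w)) (A.arc h u v w x) = A.arc h u v w x := by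
  induction v using List.reverseRecOn generalizing w with
  | nil => exact unit_slice _ _ _ _ _ (by simp) _
  | append_singleton v c ih => rw [arc_concat, unit_slice _ _ _ _ _ (by simp)]

/-- The elements of the span have the endpoints `l`: the identity of `l` fixes them. -/
theorem unit_eq_self (h₀ : A.unit [] x₀ = x₀) {x : W} (hx : x ∈ descSpan k A x₀ l) :
    A.unit l x = x := by
  have hlin : IsLinearMap k (A.unit l) := by
    have : A.unit l = A.slice [] (.id l) [] := funext fun x => by simp [slice_id]
    rw [this]
    exact hA.isLinear _ _ _
  have : descSpan k A x₀ l ≤ LinearMap.eqLocus (hlin.mk' _) LinearMap.id := by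
    refine Submodule.span_le.2 fun x hx => ?_
    change A.unit l x = x
    cases hx with
    | nil => exact h₀
    | arc h u v w _ => exact unit_arc h u v w _
  exact this hx

omit hA in
variable (k A x₀) in
/-- Crossings of neighbours preserve the span of the descending elements with endpoints `l`. -/
def CrossClosed (l : List Orientation) : Prop :=
  ∀ (o : Bool) (c d : Orientation) (p r : List Orientation) (x : W), p ++ c :: d :: r = l →
    x ∈ descSpan k A x₀ l →
      A.slice p (cross o c d) r x ∈ descSpan k A x₀ (p ++ d :: c :: r)

omit hA in
variable (k A x₀) in
/-- Maxima joining neighbours preserve the span of the descending elements with endpoints `l`. -/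
def CapClosed (l : List Orientation) : Prop :=
  ∀ (c d : Orientation) (h : c ≠ d) (p r : List Orientation) (x : W), p ++ c :: d :: r = l →
    x ∈ descSpan k A x₀ l → A.slice p (cap h) r x ∈ descSpan k A x₀ (p ++ r)

omit hA in
theorem slide_mem (o : Bool) (b : Orientation) (p v u : List Orientation)
    (hc : ∀ l' : List Orientation, l'.length = (p ++ b :: (v ++ u)).length →
      CrossClosed k A x₀ l') {x : W} (hx : x ∈ descSpan k A x₀ (p ++ b :: (v ++ u))) :
    A.slide o b p v u x ∈ descSpan k A x₀ (p ++ (v ++ b :: u)) := by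
  induction v generalizing p x with
  | nil => exact hx
  | cons c v ih =>
    have := ih (p ++ [c]) (fun l' hl' => hc l' (by simp at hl' ⊢; omega))
      (x := A.slice p (cross o b c) (v ++ u) x)
      (by simpa using hc _ rfl o b c p (v ++ u) x rfl hx)
    simpa [slide] using this

/-- A maximum joining the left endpoint of the top arc to the strand on its left. -/
theorem cap_left_arc_mem (h : a ≠ b) (p v w : List Orientation)
    (h₀ : A.unit [] x₀ = x₀)
    (hc : ∀ l' : List Orientation, l'.length = (p ++ b :: (v ++ w)).length →
      CrossClosed k A x₀ l') {x : W} (hx : x ∈ descSpan k A x₀ (p ++ b :: (v ++ w))) :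
    A.slice p (cap h.symm) (v ++ b :: w) (A.arc h (p ++ [b]) v w x) ∈
      descSpan k A x₀ (p ++ (v ++ b :: w)) := by
  have h1 := A.slice_slide_left true b p v [] w (cap h.symm)
    (A.slice (p ++ [b]) (cup h) (v ++ w) x)
  simp only [List.append_assoc, List.cons_append, List.nil_append, List.append_nil] at h1
  simp only [arc, List.append_assoc, List.cons_append, List.nil_append]
  rw [h1, hA.cap_cup_left h.symm, hA.unit_eq_self h₀ hx]
  exact slide_mem true b p v w hc hx

/-- A maximum joining the right endpoint of the top arc to the strand on its right. -/
theorem cap_right_arc_mem (h : a ≠ b) (u v r : List Orientation)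
    (h₀ : A.unit [] x₀ = x₀)
    (hc : ∀ l' : List Orientation, l'.length = (u ++ (v ++ a :: r)).length →
      CrossClosed k A x₀ l') {x : W} (hx : x ∈ descSpan k A x₀ (u ++ (v ++ a :: r))) :
    A.slice (u ++ a :: v) (cap h.symm) r (A.arc h u v (a :: r) x) ∈
      descSpan k A x₀ (u ++ a :: (v ++ r)) := by
  induction v using List.reverseRecOn generalizing r x with
  | nil =>
    have h1 := hA.cap_cup_right h u r x
    simp only [List.nil_append] at hx
    rw [hA.unit_eq_self h₀ hx] at h1
    simpa [arc, slide, h1] using hx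
  | append_singleton v e ih =>
    have h1 := hA.cap_cross true h.symm e (u ++ a :: v) r (A.arc h u v (e :: a :: r) x)
    have h2 := slice_arc_right (A := A) (cross false e a) h u v [] r x
    have h3 := ih (e :: r) (fun l' hl' => hc l' (by simp at hl' ⊢; omega))
      (x := A.slice (u ++ v) (cross false e a) r x) (by
        have := hc _ rfl false e a (u ++ v) r x (by simp) hx
        simpa using this)
    simp only [List.append_assoc, List.cons_append, List.nil_append, List.append_nil,
      Bool.not_true, arc_concat] at h1 h2 h3 ⊢
    rw [← h1, h2]
    exact h3

/-- A maximum above the top arc either moves below it, or shares an endpoint with it; in the latter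
case it straightens the arc, removes one of its crossings as a curl, or closes it to a circle. -/
theorem capClosed_of_shorter (h₀ : A.unit [] x₀ = x₀)
    (ih : ∀ l' : List Orientation, l'.length < l.length →
      CrossClosed k A x₀ l' ∧ CapClosed k A x₀ l') : CapClosed k A x₀ l := by
  intro c d h p r x hl hx
  refine mem_of_descending (hA.isLinear p (cap h) r) ?_ hx
  clear hx x
  intro x hx
  cases hx with
  | nil => simp at hl
  | @arc a b h' u v w x hx =>
    replace hx : x ∈ descSpan k A x₀ _ := Submodule.subset_span hx
    rcases append_pair_eq_append hl with
      ⟨r', rfl, rfl⟩ | ⟨rfl, rfl, rfl⟩ | ⟨rfl, rfl, hz⟩ | ⟨p', rfl, hz⟩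
    · -- the maximum is to the left of the arc
      have h1 := slice_arc_left (A := A) (cap h) h' p r' v w x
      simp only [List.append_assoc, List.cons_append, List.nil_append] at h1 hx ⊢
      rw [h1]
      have := hA.arc_mem (x₀ := x₀) h' (p ++ r') v w (x := A.slice p (cap h) (r' ++ (v ++ w)) x)
      simp only [List.append_assoc] at this
      exact this ((ih _ (by simp only [List.length_append, List.length_cons]; omega)).2
        c d h p _ x rfl hx)
    · -- it joins the left endpoint of the arc to the strand on its left
      obtain rfl : c = b := Orientation.eq_of_ne h h'.symm
      simp only [List.append_assoc, List.cons_append, List.nil_append] at hx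
      exact hA.cap_left_arc_mem h' p v w h₀ (fun l' hl' => (ih l' (by
          rw [hl']; simp only [List.length_append, List.length_cons]; omega)).1) hx
    · rcases v with _ | ⟨e, v⟩
      · -- it closes the arc to a circle
        obtain ⟨rfl, rfl⟩ := List.cons.inj hz
        obtain ⟨z, hz⟩ := hA.circle h
        change A.slice p (cap h) w (A.slice p (cup h) w x) ∈ _
        rw [hz, hA.unit_eq_self (l := p ++ w) h₀ hx]
        exact Submodule.smul_mem _ _ hx
      · -- it joins the left endpoint of the arc to the strand on its right
        rw [List.cons_append] at hz
        obtain ⟨rfl, rfl⟩ := List.cons.inj hz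
        obtain rfl : e = b := Orientation.eq_of_ne h.symm h'.symm
        obtain ⟨z, hz⟩ := hA.exists_cap_cross false h'
        rw [arc_cons hA.toIsBraided, hz]
        exact Submodule.smul_mem _ _ (hA.cap_left_arc_mem h' p v w h₀
          (fun l' hl' => (ih l' (by
          rw [hl']; simp only [List.length_append, List.length_cons]; omega)).1) hx)
    · rcases append_pair_eq_append hz.symm with
        ⟨r', rfl, rfl⟩ | ⟨rfl, rfl, rfl⟩ | ⟨rfl, rfl, rfl⟩ | ⟨p', rfl, rfl⟩
      · -- it is between the endpoints of the arc
        have h1 := slice_arc_between h' (Slides.cap hA.toIsBraided true b h) u p' r' w x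
        simp only [List.append_assoc, List.cons_append, List.nil_append] at h1 hx ⊢
        rw [h1]
        have := hA.arc_mem (x₀ := x₀) h' u (p' ++ r') w
          (x := A.slice (u ++ p') (cap h) (r' ++ w) x)
        simp only [List.append_assoc] at this
        refine this ?_
        have := (ih _ (by simp only [List.length_append, List.length_cons]; omega)).2
          c d h (u ++ p') (r' ++ w) x rfl
        simp only [List.append_assoc] at this
        exact this hx
      · -- it joins the right endpoint of the arc to the strand on its left
        obtain rfl : c = a := Orientation.eq_of_ne h h'
        obtain ⟨z, hz⟩ := hA.exists_cap_cross true h'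
        rw [arc_concat, hz]
        simp only [List.append_assoc, List.cons_append, List.nil_append] at hx ⊢
        exact Submodule.smul_mem _ _ (hA.cap_right_arc_mem h' u p' r h₀
          (fun l' hl' => (ih l' (by
          rw [hl']; simp only [List.length_append, List.length_cons]; omega)).1) hx)
      · -- it joins the right endpoint of the arc to the strand on its right
        obtain rfl : d = a := Orientation.eq_of_ne h.symm h'
        simp only [List.append_assoc, List.cons_append]
        exact hA.cap_right_arc_mem h' u p' r h₀
          (fun l' hl' => (ih l' (by
          rw [hl']; simp only [List.length_append, List.length_cons]; omega)).1) hx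
      · -- it is to the right of the arc
        have h1 := slice_arc_right (A := A) (cap h) h' u v p' r x
        simp only [List.append_assoc, List.cons_append, List.nil_append] at h1 hx ⊢
        rw [h1]
        refine hA.arc_mem h' u v (p' ++ r) ?_
        have := (ih _ (by simp only [List.length_append, List.length_cons]; omega)).2
          c d h (u ++ (v ++ p')) r x rfl
        simp only [List.append_assoc] at this
        exact this hx

/-- Since maxima and minima preserve the spans, the skein relation reduces the study of crossings
to that of one crossing of each kind. -/
theorem cross_mem_of_exists (h₀ : A.unit [] x₀ = x₀) {c d : Orientation}
    {p r : List Orientation}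
    (hl : CapClosed k A x₀ (p ++ c :: d :: r)) {x : W}
    (hx : x ∈ descSpan k A x₀ (p ++ c :: d :: r))
    (h : ∃ o, A.slice p (cross o c d) r x ∈ descSpan k A x₀ (p ++ d :: c :: r)) (o : Bool) :
    A.slice p (cross o c d) r x ∈ descSpan k A x₀ (p ++ d :: c :: r) := by
  have key : ∃ y ∈ descSpan k A x₀ (p ++ d :: c :: r),
      A.slice p (cross true c d) r x = A.slice p (cross false c d) r x + y := by
    rcases eq_or_ne c d with rfl | hcd
    · obtain ⟨z, hz⟩ := hA.exists_skein_same c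
      refine ⟨_, ?_, hz p r x⟩
      rw [hA.unit_eq_self h₀ hx]
      exact Submodule.smul_mem _ _ hx
    · obtain ⟨z, hz⟩ := hA.exists_skein_opposite hcd.symm
      exact ⟨_, Submodule.smul_mem _ _ (hA.cup_mem _ _ _ (hl c d _ p r x rfl hx)), hz p r x⟩
  obtain ⟨y, hy, hxy⟩ := key
  have hiff : A.slice p (cross true c d) r x ∈ descSpan k A x₀ (p ++ d :: c :: r) ↔
      A.slice p (cross false c d) r x ∈ descSpan k A x₀ (p ++ d :: c :: r) := by
    rw [hxy, Submodule.add_mem_iff_left _ hy]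
  obtain ⟨o', h⟩ := h
  cases o <;> cases o'
  exacts [h, hiff.1 h, hiff.2 h, h]

/-- A crossing above the top arc moves below it unless it involves an endpoint of the arc. In that
case, for a suitable choice of the strand on top, it lengthens or shortens the arc. -/
theorem crossClosed_of_shorter (h₀ : A.unit [] x₀ = x₀)
    (ih : ∀ l' : List Orientation, l'.length < l.length →
      CrossClosed k A x₀ l' ∧ CapClosed k A x₀ l') (hcap : CapClosed k A x₀ l) :
    CrossClosed k A x₀ l := by
  intro o c d p r x hl hx
  refine mem_of_descending (hA.isLinear p (cross o c d) r) ?_ hx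
  clear hx x
  intro x hx
  have hx' : x ∈ descSpan k A x₀ l := Submodule.subset_span hx
  subst hl
  refine hA.cross_mem_of_exists h₀ hcap hx' ?_ o
  generalize hl : p ++ c :: d :: r = l at *
  cases hx with
  | nil => simp at hl
  | @arc a b h' u v w x hx =>
    replace hx : x ∈ descSpan k A x₀ _ := Submodule.subset_span hx
    rcases append_pair_eq_append hl with
      ⟨r', rfl, rfl⟩ | ⟨rfl, rfl, rfl⟩ | ⟨rfl, rfl, hz⟩ | ⟨p', rfl, hz⟩
    · -- the crossing is to the left of the arc
      have h1 := slice_arc_left (A := A) (cross o c d) h' p r' v w x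
      refine ⟨o, ?_⟩
      simp only [List.append_assoc, List.cons_append, List.nil_append] at h1 hx ⊢
      rw [h1]
      have := hA.arc_mem (x₀ := x₀) h' (p ++ d :: c :: r') v w
        (x := A.slice p (cross o c d) (r' ++ (v ++ w)) x)
      simp only [List.append_assoc, List.cons_append] at this
      exact this ((ih _ (by simp only [List.length_append, List.length_cons]; omega)).1
        o c d p _ x rfl hx)
    · -- the arc crosses the strand to the left of its left endpoint
      refine ⟨false, ?_⟩
      rw [← arc_cons hA.toIsBraided]
      simp only [List.append_assoc, List.cons_append, List.nil_append] at hx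
      exact hA.arc_mem h' p (c :: v) w hx
    · rcases v with _ | ⟨e, v⟩
      · -- the arc crosses itself
        obtain ⟨rfl, rfl⟩ := List.cons.inj hz
        obtain ⟨z, hz⟩ := hA.exists_cross_cup o h'
        refine ⟨o, ?_⟩
        change A.slice p (cross o c b) w (A.slice p (cup h') w x) ∈ _
        rw [hz]
        exact Submodule.smul_mem _ _ (hA.cup_mem _ _ _ hx)
      · -- the crossing undoes one of the arc with the strand to the right of its left endpoint
        rw [List.cons_append] at hz
        obtain ⟨rfl, rfl⟩ := List.cons.inj hz
        refine ⟨true, ?_⟩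
        have hx1 : A.arc h' (p ++ [e]) v w x ∈
            descSpan k A x₀ (p ++ e :: c :: (v ++ b :: w)) := by
          simpa using hA.arc_mem h' (p ++ [e]) v w (x := x) (by simpa using hx)
        have h1 := hA.cross_cross false e c p (v ++ b :: w) (A.arc h' (p ++ [e]) v w x)
        rw [hA.unit_eq_self h₀ hx1, Bool.not_false] at h1
        rw [arc_cons hA.toIsBraided]
        exact (congrArg (· ∈ descSpan k A x₀ _) h1).mpr hx1
    · rcases append_pair_eq_append hz.symm with
        ⟨r', rfl, rfl⟩ | ⟨rfl, rfl, rfl⟩ | ⟨rfl, rfl, rfl⟩ | ⟨p', rfl, rfl⟩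
      · -- the crossing is between the endpoints of the arc
        refine ⟨o, ?_⟩
        have h1 := slice_arc_between h' (hA.cross_slides true o b c d) u p' r' w x
        simp only [List.append_assoc, List.cons_append, List.nil_append] at h1 hx ⊢
        rw [h1]
        have := hA.arc_mem (x₀ := x₀) h' u (p' ++ d :: c :: r') w
          (x := A.slice (u ++ p') (cross o c d) (r' ++ w) x)
        simp only [List.append_assoc, List.cons_append] at this
        refine this ?_
        have := (ih _ (by simp only [List.length_append, List.length_cons]; omega)).1
          o c d (u ++ p') (r' ++ w) x rfl
        simp only [List.append_assoc] at this
        exact this hx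
      · -- the crossing undoes one of the arc with the strand to the left of its right endpoint
        refine ⟨false, ?_⟩
        have hx1 : A.arc h' u p' (c :: r) x ∈
            descSpan k A x₀ (u ++ a :: p' ++ d :: c :: r) := by
          simpa using hA.arc_mem h' u p' (c :: r) (x := x) (by simpa using hx)
        have h1 := hA.cross_cross true d c (u ++ a :: p') r (A.arc h' u p' (c :: r) x)
        rw [hA.unit_eq_self h₀ hx1, Bool.not_true] at h1
        rw [arc_concat, h1]
        exact hx1
      · -- the arc crosses the strand to the right of its right endpoint
        refine ⟨true, ?_⟩
        rw [← arc_concat]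
        simpa using hA.arc_mem h' u (p' ++ [d]) r (x := x) (by simpa using hx)
      · -- the crossing is to the right of the arc
        refine ⟨o, ?_⟩
        have h1 := slice_arc_right (A := A) (cross o c d) h' u v p' r x
        simp only [List.append_assoc, List.cons_append, List.nil_append] at h1 hx ⊢
        rw [h1]
        refine hA.arc_mem h' u v (p' ++ d :: c :: r) ?_
        have := (ih _ (by simp only [List.length_append, List.length_cons]; omega)).1
          o c d (u ++ (v ++ p')) r x rfl
        simp only [List.append_assoc] at this
        exact this hx

theorem crossClosed_and_capClosed (h₀ : A.unit [] x₀ = x₀) (l : List Orientation) :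
    CrossClosed k A x₀ l ∧ CapClosed k A x₀ l := by
  induction hn : l.length using Nat.strong_induction_on generalizing l with
  | _ n ih =>
    have ih' : ∀ l' : List Orientation, l'.length < l.length →
        CrossClosed k A x₀ l' ∧ CapClosed k A x₀ l' := fun l' hl' => ih _ (hn ▸ hl') l' rfl
    have hcap := hA.capClosed_of_shorter h₀ ih'
    exact ⟨hA.crossClosed_of_shorter h₀ ih' hcap, hcap⟩

/-- All diagrams preserve the spans of the descending elements. -/
theorem slice_mem (h₀ : A.unit [] x₀ = x₀) {s t : List Orientation} (K : Diagram s t)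
    (p u : List Orientation) {x : W} (hx : x ∈ descSpan k A x₀ (p ++ s ++ u)) :
    A.slice p K u x ∈ descSpan k A x₀ (p ++ t ++ u) := by
  induction K generalizing p u x with
  | id s => rwa [slice_id, hA.unit_eq_self h₀ hx]
  | cup h => simpa using hA.cup_mem h p u (by simpa using hx)
  | cap h =>
    simpa using (hA.crossClosed_and_capClosed h₀ _).2 _ _ h p u x rfl (by simpa using hx)
  | cross o a b =>
    simpa using (hA.crossClosed_and_capClosed h₀ _).1 o a b p u x rfl (by simpa using hx)
  | comp f g hf hg =>
    rw [slice_comp]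
    exact hg p u (hf p u hx)
  | @tensor s t s' t' f g hf hg =>
    rw [(A.slice_tensor p f g u x).1]
    have h1 := hf p (s' ++ u) (x := x) (by simpa using hx)
    have h2 := hg (p ++ t) u (x := A.slice p f (s' ++ u) x) (by simpa using h1)
    simpa using h2

/-- Links act on the initial vector by scalars. -/
theorem exists_act_eq_smul (h₀ : A.unit [] x₀ = x₀) (K : Diagram [] []) :
    ∃ c : k, A.act K x₀ = c • x₀ := by
  have h1 := hA.slice_mem h₀ K [] [] (Submodule.subset_span Descending.nil)
  rw [slice_nil] at h1
  have h2 : descSpan k A x₀ [] ≤ Submodule.span k {x₀} := by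
    refine Submodule.span_le.2 fun x hx => ?_
    generalize hl : ([] : List Orientation) = l at hx
    cases hx with
    | nil => exact Submodule.mem_span_singleton_self _
    | arc h u v w _ => simp at hl
  obtain ⟨c, hc⟩ := Submodule.mem_span_singleton.1 (h2 h1)
  exact ⟨c, hc.symm⟩

end IsSkein
end DiagramAction
end Homfly

namespace Homfly
open Homfly.Diagram Homfly.Orientation

section
open DiagramAction

/-- The module structure of `BrSpace`, over the semiring that underlies the commutative ring `𝕜`
and the monoid that underlies the additive group `BrSpace`. -/
noncomputable instance : @Module BaseRing BrSpace
    (@CommSemiring.toSemiring _ CommRing.toCommSemiring) AddCommGroup.toAddCommMonoid :=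
  (inferInstance : Module BaseRing BrSpace)

theorem brAction_isSkein : brAction.IsSkein BaseRing where
  toIsBraided := brAction_isBraided
  isLinear := isLinearMap_slice
  cross_slides := brAction_slides
  skein_up := ⟨qInv - q, fun p u x => by
    have := linAct_eq_of_relator p u x (sub_sub (diag (cross true up up)) _ _ ▸ Relator.skein)
    simpa only [map_add, map_smul, linAct_diag, slice_id, List.append_assoc, List.cons_append,
      List.nil_append] using this⟩
  circle h := ⟨betaNumber, fun p u x => by
    have := linAct_eq_of_relator p u x (Relator.circle h)
    simpa only [map_smul, linAct_diag, slice_id, slice_comp, List.append_nil] using this⟩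
  curl_right o h := ⟨qBeta (if o then -1 else 1), fun p u x => by
    have := linAct_eq_of_relator p u x (Relator.curl_right o h)
    simpa only [map_smul, linAct_diag, slice_id, slice_comp, slice_tensor_left,
      slice_tensor_right, List.append_assoc, List.cons_append, List.nil_append] using this⟩
  curl_left o h := ⟨qBeta (if o then -1 else 1), fun p u x => by
    have := linAct_eq_of_relator p u x (Relator.curl_left o h)
    simpa only [map_smul, linAct_diag, slice_id, slice_comp, slice_tensor_left,
      slice_tensor_right, List.append_assoc, List.cons_append, List.nil_append] using this⟩

end

/-- Every endomorphism of the empty sequence in `Br(β)` is a scalar. -/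
theorem scalarEnd_surjective : Function.Surjective scalarEnd := by
  classical
  let x₀ : BrSpace := Pi.single [] (quotientFunctor (Tangle.id []))
  have hact : ∀ T : Tangle [] [], tangleAct T x₀ = Pi.single [] (quotientFunctor T) := by
    intro T
    simp only [tangleAct, x₀, LinearMap.comp_apply, LinearMap.proj_apply, Pi.single_eq_same,
      stackBr_quotientFunctor, Tangle.id_comp, LinearMap.single_apply]
  have hL : ∀ T : Tangle [] [], quotientFunctor T ∈ LinearMap.range scalarEnd := by
    intro T
    obtain ⟨K, rfl⟩ := Quotient.exists_rep T
    obtain ⟨c, hc⟩ := brAction_isSkein.exists_act_eq_smul (x₀ := x₀) (hact _) K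
    have h := congrFun ((hact _).symm.trans hc) []
    have h0 : x₀ [] = quotientFunctor (Tangle.id []) := Pi.single_eq_same _ _
    rw [Pi.single_eq_same, Pi.smul_apply, h0] at h
    exact ⟨c, h.symm⟩
  rw [← LinearMap.range_eq_top, eq_top_iff]
  rintro z -
  obtain ⟨z, rfl⟩ := Submodule.Quotient.mk_surjective _ z
  induction z using Finsupp.induction_linear with
  | zero => exact Submodule.zero_mem _
  | add z z' h h' => exact Submodule.add_mem _ h h'
  | single T c =>
    have := Submodule.smul_mem _ c (hL T)
    rwa [quotientFunctor, ← map_smul, Finsupp.smul_single, smul_eq_mul, mul_one] at this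

/-! ### The symmetry -/

theorem qFlip_qInv : qFlip qInv = -q := by
  change AddMonoidAlgebra.mapRingHom ℤ ratFuncFlip.toRingHom (AddMonoidAlgebra.single 0 _) = _
  rw [AddMonoidAlgebra.mapRingHom_single]
  change LaurentPolynomial.C (ratFuncFlip (RatFunc.X)⁻¹) = _
  have h : ratFuncFlip (RatFunc.X)⁻¹ = -RatFunc.X := by
    rw [map_inv₀, ratFuncFlip_X, neg_inv, inv_inv]
  rw [h, map_neg]
  rfl

theorem qFlip_betaNumber : qFlip betaNumber = betaNumber := by
  rw [betaNumber, map_mul, map_sub, qFlip_qBeta, qFlip_qBeta]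
  congr 1
  change AddMonoidAlgebra.mapRingHom ℤ ratFuncFlip.toRingHom (AddMonoidAlgebra.single 0 _) = _
  rw [AddMonoidAlgebra.mapRingHom_single]
  change LaurentPolynomial.C (ratFuncFlip _) = _
  have h : ratFuncFlip ((RatFunc.X : RatFunc ℂ) - (RatFunc.X)⁻¹)⁻¹ =
      ((RatFunc.X : RatFunc ℂ) - (RatFunc.X)⁻¹)⁻¹ := by
    rw [map_inv₀, map_sub, map_inv₀, ratFuncFlip_X, neg_inv, inv_inv, ← neg_inv, neg_sub_neg]
  rw [h]

variable {s t : List Orientation}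

/-- The substitution `q ↦ -q⁻¹` in the coefficients of a linear combination of tangles. -/
noncomputable def coeffFlip : LinTangle s t →+ LinTangle s t :=
  Finsupp.mapRange.addMonoidHom qFlip.toAddMonoidHom

theorem coeffFlip_single (T : Tangle s t) (c : BaseRing) :
    coeffFlip (Finsupp.single T c) = Finsupp.single T (qFlip c) := by
  simp [coeffFlip]

theorem coeffFlip_smul (c : BaseRing) (z : LinTangle s t) :
    coeffFlip (c • z) = qFlip c • coeffFlip z := by
  induction z using Finsupp.induction_linear with
  | zero => simp
  | add z z' h h' => rw [smul_add, map_add, h, h', map_add, smul_add]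
  | single T d => simp only [Finsupp.smul_single, coeffFlip_single, smul_eq_mul, map_mul]

theorem coeffFlip_diag (K : Diagram s t) : coeffFlip (diag K) = diag K := by
  rw [diag, coeffFlip_single, map_one]

/-- The coefficients of the defining relations are invariant under `q ↦ -q⁻¹`. -/
theorem coeffFlip_relator {r : LinTangle s t} (hr : Relator s t r) : coeffFlip r = r := by
  cases hr with
  | skein =>
    rw [map_sub, map_sub, coeffFlip_smul, coeffFlip_diag, coeffFlip_diag, coeffFlip_diag, map_sub,
      qFlip_q, qFlip_qInv, neg_sub_neg]
  | circle h => rw [map_sub, coeffFlip_smul, coeffFlip_diag, coeffFlip_diag, qFlip_betaNumber]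
  | curl_right o h => rw [map_sub, coeffFlip_smul, coeffFlip_diag, coeffFlip_diag, qFlip_qBeta]
  | curl_left o h => rw [map_sub, coeffFlip_smul, coeffFlip_diag, coeffFlip_diag, qFlip_qBeta]

theorem coeffFlip_plug {x y : List Orientation} (u v : List Orientation)
    (f : Tangle s (u ++ x ++ v)) (g : Tangle (u ++ y ++ v) t) (r : LinTangle x y) :
    coeffFlip (plug u v f g r) = plug u v f g (coeffFlip r) := by
  induction r using Finsupp.induction_linear with
  | zero => simp
  | add r r' h h' => rw [map_add, map_add, h, h', map_add, map_add]
  | single T d =>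
    simp only [plug, Finsupp.lmapDomain_apply, Finsupp.mapDomain_single, coeffFlip_single]

theorem coeffFlip_mem_relatorIdeal {z : LinTangle s t} (hz : z ∈ relatorIdeal s t) :
    coeffFlip z ∈ relatorIdeal s t := by
  induction hz using Submodule.span_induction with
  | mem z hz =>
    obtain ⟨x, y, u, v, f, g, r, hr, rfl⟩ := hz
    rw [coeffFlip_plug, coeffFlip_relator hr]
    exact Submodule.subset_span ⟨x, y, u, v, f, g, r, hr, rfl⟩
  | zero => simp
  | add z z' _ _ h h' => rw [map_add]; exact Submodule.add_mem _ h h'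
  | smul c z _ h => rw [coeffFlip_smul]; exact Submodule.smul_mem _ _ h

/-- If a link equals a scalar in `Br(β)`, it also equals the image of that scalar under
`q ↦ -q⁻¹`. -/
theorem scalarEnd_qFlip {L : FramedLink} {c : BaseRing} (h : scalarEnd c = quotientFunctor L) :
    scalarEnd (qFlip c) = quotientFunctor L := by
  have key : ∀ c, scalarEnd c = (relatorIdeal [] []).mkQ (Finsupp.single (Tangle.id []) c) := by
    intro c
    rw [scalarEnd, LinearMap.toSpanSingleton_apply, quotientFunctor, ← map_smul,
      Finsupp.smul_single, smul_eq_mul, mul_one]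
  rw [key, quotientFunctor, ← sub_eq_zero, ← map_sub] at h ⊢
  have h2 := coeffFlip_mem_relatorIdeal ((Submodule.Quotient.mk_eq_zero _).1 h)
  rw [map_sub, coeffFlip_single, coeffFlip_single, map_one] at h2
  exact (Submodule.Quotient.mk_eq_zero _).2 h2

end Homfly

namespace Homfly
open Homfly.Diagram Homfly.Orientation

/-! ### State sums -/

section Words

variable (K C : Type*) [Field K]

/-- The vector space with basis the words in the colours `C`. -/
abbrev WordSpace : Type _ := List C →₀ K

variable {K C}

/-- The basis vector of a word. -/
noncomputable def word (w : List C) : WordSpace K C := Finsupp.single w 1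

/-- The bilinear extension of the concatenation of words. -/
noncomputable def juxt : WordSpace K C →ₗ[K] WordSpace K C →ₗ[K] WordSpace K C :=
  Finsupp.linearCombination K fun u => Finsupp.lmapDomain K K (u ++ ·)

theorem single_eq_smul_word (w : List C) (c : K) : Finsupp.single w c = c • word w := by
  simp [word]

@[simp]
theorem juxt_word (u v : List C) : juxt (word u) (word v) = (word (u ++ v) : WordSpace K C) := by
  simp [juxt, word, Finsupp.mapDomain_single]

@[simp]
theorem juxt_ite_left (p : Prop) [Decidable p] (x y : WordSpace K C) :
    juxt (if p then x else 0) y = if p then juxt x y else 0 := by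
  split_ifs <;> simp

@[simp]
theorem juxt_ite_right (p : Prop) [Decidable p] (x y : WordSpace K C) :
    juxt x (if p then y else 0) = if p then juxt x y else 0 := by
  split_ifs <;> simp

theorem word_ext {M : Type*} [AddCommGroup M] [Module K M] {f g : WordSpace K C →ₗ[K] M}
    (h : ∀ w, f (word w) = g (word w)) : f = g :=
  Finsupp.lhom_ext' fun w => LinearMap.ext_ring (h w)

theorem juxt_nil_left (y : WordSpace K C) : juxt (word []) y = y := by
  have : juxt (word []) = (LinearMap.id : WordSpace K C →ₗ[K] _) := word_ext fun w => by simp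
  rw [this, LinearMap.id_apply]

theorem juxt_nil_right (y : WordSpace K C) : juxt y (word []) = y := by
  have : juxt.flip (word []) = (LinearMap.id : WordSpace K C →ₗ[K] _) :=
    word_ext fun w => by simp
  simpa using LinearMap.congr_fun this y

theorem juxt_assoc (x y z : WordSpace K C) : juxt (juxt x y) z = juxt x (juxt y z) := by
  induction x using Finsupp.induction_linear with
  | zero => simp
  | add x x' h h' => simp only [map_add, LinearMap.add_apply, h, h']
  | single u a =>
    induction y using Finsupp.induction_linear with
    | zero => simp
    | add y y' h h' => simp only [map_add, LinearMap.add_apply, h, h']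
    | single v b =>
      induction z using Finsupp.induction_linear with
      | zero => simp
      | add z z' h h' => simp only [map_add, h, h']
      | single w c =>
        simp only [single_eq_smul_word, map_smul, LinearMap.smul_apply, juxt_word,
          List.append_assoc]

/-- The linear combinations of words of length `n`. -/
def homogeneous (K C : Type*) [Field K] (n : ℕ) : Submodule K (WordSpace K C) :=
  Finsupp.supported K K {w : List C | w.length = n}

theorem word_mem_homogeneous {w : List C} {n : ℕ} (h : w.length = n) :
    word w ∈ homogeneous K C n :=
  Finsupp.single_mem_supported K 1 h

theorem eq_on_homogeneous {M : Type*} [AddCommGroup M] [Module K M] {n : ℕ}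
    {f g : WordSpace K C →ₗ[K] M} (h : ∀ w : List C, w.length = n → f (word w) = g (word w))
    {y : WordSpace K C} (hy : y ∈ homogeneous K C n) : f y = g y := by
  rw [homogeneous, Finsupp.supported_eq_span_single] at hy
  have : Submodule.span K ((fun w => Finsupp.single w (1 : K)) '' {w : List C | w.length = n}) ≤
      LinearMap.eqLocus f g := Submodule.span_le.2 (by rintro _ ⟨w, hw, rfl⟩; exact h w hw)
  exact this hy

theorem juxt_mem_homogeneous {m n : ℕ} {x y : WordSpace K C} (hx : x ∈ homogeneous K C m)
    (hy : y ∈ homogeneous K C n) : juxt x y ∈ homogeneous K C (m + n) := by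
  rw [homogeneous, Finsupp.supported_eq_span_single] at hx hy
  induction hx using Submodule.span_induction with
  | zero => simp
  | add x x' _ _ h h' => rw [map_add]; exact Submodule.add_mem _ h h'
  | smul c x _ h => rw [map_smul]; exact Submodule.smul_mem _ _ h
  | mem x hx =>
    obtain ⟨u, hu, rfl⟩ := hx
    induction hy using Submodule.span_induction with
    | zero => simp
    | add y y' _ _ h h' => rw [map_add]; exact Submodule.add_mem _ h h'
    | smul c y _ h => rw [map_smul]; exact Submodule.smul_mem _ _ h
    | mem y hy =>
      obtain ⟨v, hv, rfl⟩ := hy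
      change juxt (word u) (word v) ∈ _
      rw [juxt_word]
      exact word_mem_homogeneous (by rw [List.length_append, hu, hv])

/-- The linear extension of a map defined on words. -/
noncomputable def extend (f : List C → WordSpace K C) : WordSpace K C →ₗ[K] WordSpace K C :=
  Finsupp.linearCombination K f

@[simp]
theorem extend_word (f : List C → WordSpace K C) (w : List C) : extend f (word w) = f w := by
  simp [extend, word]

theorem extend_mem_homogeneous {f : List C → WordSpace K C} {n : ℕ}
    (h : ∀ w, f w ∈ homogeneous K C n) (y : WordSpace K C) :
    extend f y ∈ homogeneous K C n := by
  induction y using Finsupp.induction_linear with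
  | zero => simp
  | add x x' h h' => rw [map_add]; exact Submodule.add_mem _ h h'
  | single w c =>
    rw [extend, Finsupp.linearCombination_single]
    exact Submodule.smul_mem _ _ (h w)

theorem extend_zero : extend (fun _ : List C => (0 : WordSpace K C)) = 0 :=
  word_ext fun w => by simp

theorem extend_add (f g : List C → WordSpace K C) :
    extend (fun w => f w + g w) = extend f + extend g :=
  word_ext fun w => by simp

theorem extend_smul (c : K) (f : List C → WordSpace K C) :
    extend (fun w => c • f w) = c • extend f :=
  word_ext fun w => by simp

theorem extend_extend (f g : List C → WordSpace K C) (y : WordSpace K C) :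
    extend (fun w => extend g (f w)) y = extend g (extend f y) := by
  have : extend (fun w => extend g (f w)) = extend g ∘ₗ extend f := word_ext fun w => by simp
  rw [this, LinearMap.comp_apply]

end Words

/-- The weights of a state sum with colours `C`: the matrices of minima and maxima with left
endpoint `a`, and of crossings. -/
structure Weights (K C : Type*) [Field K] where
  /-- minima -/
  cup : Orientation → WordSpace K C
  /-- maxima -/
  cap : Orientation → C → C → WordSpace K C
  /-- crossings -/
  cross : Bool → Orientation → Orientation → C → C → WordSpace K C
  cup_mem : ∀ a, cup a ∈ homogeneous K C 2
  cap_mem : ∀ a i j, cap a i j ∈ homogeneous K C 0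
  cross_mem : ∀ o a b i j, cross o a b i j ∈ homogeneous K C 2

namespace Weights

variable {K C : Type*} [Field K] (V : Weights K C) {s t u v s' t' u' v' : List Orientation}

/-- The column of the matrix of a diagram that belongs to a colouring of its bottom endpoints;
it is zero if the number of colours is wrong. -/
noncomputable def col : ∀ {s t : List Orientation}, Diagram s t → List C → WordSpace K C
  | _, _, .id s, w => if w.length = s.length then word w else 0
  | _, _, .cup (a := a) _, [] => V.cup a
  | _, _, .cup _, _ :: _ => 0
  | _, _, .cap (a := a) _, [i, j] => V.cap a i j
  | _, _, .cap _, _ => 0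
  | _, _, .cross o a b, [i, j] => V.cross o a b i j
  | _, _, .cross _ _ _, _ => 0
  | _, _, .comp f g, w => extend (col g) (col f w)
  | _, _, .tensor (s := s) f g, w =>
      juxt (col f (w.take s.length)) (col g (w.drop s.length))

section
variable {a b c d : Orientation} (i j k : C) (w : List C)

@[simp]
theorem col_id_nil : V.col (.id []) [] = word [] := by simp [col]

@[simp]
theorem col_id_one : V.col (.id [a]) [i] = word [i] := by simp [col]

@[simp]
theorem col_id_two : V.col (.id [a, b]) [i, j] = word [i, j] := by simp [col]

@[simp]
theorem col_cup (h : a ≠ b) : V.col (.cup h) [] = V.cup a := by rw [col]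

@[simp]
theorem col_cap (h : a ≠ b) : V.col (.cap h) [i, j] = V.cap a i j := by rw [col]

@[simp]
theorem col_cross (o : Bool) : V.col (.cross o a b) [i, j] = V.cross o a b i j := by rw [col]

@[simp]
theorem col_comp (f : Diagram s t) (g : Diagram t u) :
    V.col (.comp f g) w = extend (V.col g) (V.col f w) := by rw [col]

@[simp]
theorem col_tensor_one (f : Diagram [] t) :
    V.col (.tensor f (.id [a])) [i] = juxt (V.col f []) (word [i]) := by
  simp [col]

@[simp]
theorem col_one_tensor (f : Diagram s t) :
    V.col (.tensor (.id [a]) f) (i :: w) = juxt (word [i]) (V.col f w) := by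
  simp [col]

@[simp]
theorem col_two_tensor_one (f : Diagram [a, b] t) :
    V.col (.tensor f (.id [c])) [i, j, k] = juxt (V.col f [i, j]) (word [k]) := by
  simp [col]

end

theorem col_mem (f : Diagram s t) (w : List C) : V.col f w ∈ homogeneous K C t.length := by
  induction f generalizing w with
  | id s =>
    rw [col]
    split_ifs with h
    · exact word_mem_homogeneous h
    · exact Submodule.zero_mem _
  | cup h =>
    rcases w with _ | ⟨i, w⟩ <;> rw [col]
    · exact V.cup_mem _
    · exact Submodule.zero_mem _
  | cap h =>
    rcases w with _ | ⟨i, _ | ⟨j, _ | ⟨k, w⟩⟩⟩ <;> rw [col] <;>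
      first | exact V.cap_mem _ _ _ | exact Submodule.zero_mem _ | simp
  | cross o a b =>
    rcases w with _ | ⟨i, _ | ⟨j, _ | ⟨k, w⟩⟩⟩ <;> rw [col] <;>
      first | exact V.cross_mem _ _ _ _ _ | exact Submodule.zero_mem _ | simp
  | comp f g hf hg => rw [col]; exact extend_mem_homogeneous hg _
  | tensor f g hf hg =>
    rw [col, List.length_append]
    exact juxt_mem_homogeneous (hf _) (hg _)

theorem col_eq_zero (f : Diagram s t) (w : List C) (h : w.length ≠ s.length) : V.col f w = 0 := by
  induction f generalizing w with
  | id s => rw [col, if_neg h]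
  | cup h =>
    rcases w with _ | ⟨i, w⟩
    · simp at h
    · rw [col]
  | cap h =>
    rcases w with _ | ⟨i, _ | ⟨j, _ | ⟨k, w⟩⟩⟩ <;> simp_all [col]
  | cross o a b =>
    rcases w with _ | ⟨i, _ | ⟨j, _ | ⟨k, w⟩⟩⟩ <;> simp_all [col]
  | comp f g hf hg => rw [col, hf _ h, map_zero]
  | @tensor s t s' t' f g hf hg =>
    rw [col]
    by_cases h1 : (w.take s.length).length = s.length
    · rw [hg, map_zero]
      simp at h1 h ⊢
      omega
    · rw [hf _ h1, map_zero, LinearMap.zero_apply]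

/-- Two diagrams with the same endpoints have the same matrix. -/
def SameMatrix (f : Diagram s t) (g : Diagram s' t') : Prop :=
  s = s' ∧ t = t' ∧ V.col f = V.col g

/-- Only the colourings with one colour for each endpoint need to be compared. -/
theorem sameMatrix_of_words {f g : Diagram s t}
    (h : ∀ w : List C, w.length = s.length → V.col f w = V.col g w) : V.SameMatrix f g := by
  refine ⟨rfl, rfl, funext fun w => ?_⟩
  by_cases hw : w.length = s.length
  · exact h w hw
  · rw [V.col_eq_zero f w hw, V.col_eq_zero g w hw]

theorem extend_col_id {y : WordSpace K C} (hy : y ∈ homogeneous K C t.length) :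
    extend (V.col (.id t)) y = y := by
  refine eq_on_homogeneous (g := LinearMap.id) (fun w hw => ?_) hy
  rw [extend_word, col, if_pos hw, LinearMap.id_apply]

theorem extend_col_tensor (f : Diagram s t) (g : Diagram s' t') {x y : WordSpace K C}
    (hx : x ∈ homogeneous K C s.length) :
    extend (V.col (.tensor f g)) (juxt x y) = juxt (extend (V.col f) x) (extend (V.col g) y) := by
  refine eq_on_homogeneous (f := extend (V.col (.tensor f g)) ∘ₗ juxt.flip y)
    (g := juxt.flip (extend (V.col g) y) ∘ₗ extend (V.col f)) (fun w hw => ?_) hx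
  have : extend (V.col (.tensor f g)) ∘ₗ juxt (word w) =
      juxt (V.col f w) ∘ₗ extend (V.col g) := word_ext fun w' => by simp [col, ← hw]
  simpa using LinearMap.congr_fun this y

theorem sameMatrix_monoidalCongruence : MonoidalCongruence V.SameMatrix where
  refl f := ⟨rfl, rfl, rfl⟩
  symm h := ⟨h.1.symm, h.2.1.symm, h.2.2.symm⟩
  trans h h' := ⟨h.1.trans h'.1, h.2.1.trans h'.2.1, h.2.2.trans h'.2.2⟩
  comp_congr := by
    rintro _ _ _ _ _ _ f g f' g' ⟨rfl, rfl, h⟩ ⟨-, rfl, h'⟩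
    exact ⟨rfl, rfl, funext fun w => by rw [col, col, h, h']⟩
  tensor_congr := by
    rintro _ _ _ _ _ _ _ _ f g f' g' ⟨rfl, rfl, h⟩ ⟨rfl, rfl, h'⟩
    exact ⟨rfl, rfl, funext fun w => by rw [col, col, h, h']⟩
  id_comp f := V.sameMatrix_of_words fun w hw => by rw [col, col, if_pos hw, extend_word]
  comp_id f := ⟨rfl, rfl, funext fun w => by rw [col, V.extend_col_id (V.col_mem f w)]⟩
  comp_assoc f g h := ⟨rfl, rfl, funext fun w => by
    rw [col, col, col, ← extend_extend]
    rfl⟩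
  tensor_id s t := V.sameMatrix_of_words fun w hw => by
    rw [List.length_append] at hw
    rw [col, col, col, col, if_pos, if_pos, if_pos, juxt_word, List.take_append_drop]
    all_goals simp; try omega
  tensor_comp f g f' g' := ⟨rfl, rfl, funext fun w => by
    rw [col, col, col, col, col, V.extend_col_tensor _ _ (V.col_mem f _)]⟩
  unit_tensor f := ⟨rfl, rfl, funext fun w => by
    rw [col, col, if_pos (by simp)]
    exact juxt_nil_left _⟩
  tensor_unit {s t} f := ⟨List.append_nil s, List.append_nil t, funext fun w => by
    by_cases hw : w.length = s.length
    · rw [col, List.drop_of_length_le hw.le, List.take_of_length_le hw.le, col,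
        if_pos (by simp),
        juxt_nil_right]
    · rw [V.col_eq_zero f w hw, V.col_eq_zero _ w (by simpa using hw)]⟩
  tensor_assoc {s t s' t' s'' t''} f g h :=
    ⟨List.append_assoc _ _ _, List.append_assoc _ _ _, funext fun w => by
      rw [col, col, col, col, juxt_assoc, List.length_append, List.take_take, List.drop_drop,
        List.drop_take, Nat.min_eq_left (Nat.le_add_right _ _), Nat.add_sub_cancel_left]⟩

/-- Diagrams act on words by their matrices. -/
noncomputable def action : DiagramAction (WordSpace K C) where
  rel := V.SameMatrix
  act K x := extend (V.col K) x
  isCongr := V.sameMatrix_monoidalCongruence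
  act_congr h := by rw [h.2.2]
  act_comp f g x := extend_extend (V.col f) (V.col g) x

end Weights
end Homfly

namespace Homfly
open Homfly.Diagram Homfly.Orientation

/-! ### The state sum of `gl(N)` -/

namespace Gl

variable {K : Type*} [Field K] (q : K) (N : ℕ)

/-- The weight of a crossing at which the colours `i` and `j` follow the strands and so exchange
their positions. -/
def pass (o : Bool) (i j : Fin N) : K := if i = j then (if o then q⁻¹ else q) else 1

/-- The weight of a crossing of two upward strands at which the colours, `i` on the left and `j` on
the right, keep their positions. -/
def turn : Bool → Fin N → Fin N → K
  | true, i, j => if j < i then q⁻¹ - q else 0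
  | false, i, j => if i < j then -(q⁻¹ - q) else 0

/-- The powers `κ_n = q^{2n+1-N}`; their sum over `0 ≤ n < N` is the quantum integer `[N]`. -/
def kap (n : ℕ) : K := q ^ (2 * n + 1) * (q ^ N)⁻¹

/-- The weight of a maximum with left endpoint `a`. -/
def capWeight : Orientation → Fin N → K
  | up, i => kap q N i
  | down, _ => 1

/-- The weight of a minimum with left endpoint `a`. -/
def cupWeight : Orientation → Fin N → K
  | up, _ => 1
  | down, i => (kap q N i)⁻¹

/-- The matrix of a crossing. For upward strands this is the `R`-matrix of the vector
representation of the quantum group of `gl(N)`; the other orientations are obtained by rotation. -/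
noncomputable def crossWeight (o : Bool) :
    Orientation → Orientation → Fin N → Fin N → WordSpace K (Fin N)
  | up, up, i, j => pass q N o i j • word [j, i] + turn q N o i j • word [i, j]
  | down, down, i, j => pass q N o i j • word [j, i] + turn q N o j i • word [i, j]
  | down, up, i, j => pass q N (!o) i j • word [j, i] +
      if i = j then ∑ y, turn q N (!o) i y • word [y, y] else 0
  | up, down, i, j => pass q N (!o) i j • word [j, i] +
      if i = j then ∑ y, (turn q N (!o) y i * kap q N i * (kap q N y)⁻¹) • word [y, y] else 0

/-- The weights of the vector representation of the quantum group of `gl(N)`. -/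
noncomputable def weights : Weights K (Fin N) where
  cup a := ∑ i, cupWeight q N a i • word [i, i]
  cap a i j := (if i = j then capWeight q N a i else 0) • word []
  cross o a b i j := crossWeight q N o a b i j
  cup_mem a := Submodule.sum_mem _ fun i _ => Submodule.smul_mem _ _ (word_mem_homogeneous rfl)
  cap_mem a i j := Submodule.smul_mem _ _ (word_mem_homogeneous rfl)
  cross_mem o a b i j := by
    have h : ∀ (c : K) (i j : Fin N), c • word [i, j] ∈ homogeneous K (Fin N) 2 :=
      fun c i j => Submodule.smul_mem _ _ (word_mem_homogeneous rfl)
    cases a <;> cases b <;> refine Submodule.add_mem _ (h _ _ _) ?_ <;>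
      first
        | exact h _ _ _
        | (split_ifs
           · exact Submodule.sum_mem _ fun y _ => h _ _ _
           · exact Submodule.zero_mem _)

variable {q N}

@[simp]
theorem weights_cup_up : (weights q N).cup up = ∑ i, word [i, i] := by
  simp [weights, cupWeight]

@[simp]
theorem weights_cup_down :
    (weights q N).cup down = ∑ i : Fin N, (kap q N i)⁻¹ • word [i, i] :=
  rfl

@[simp]
theorem juxt_cap_left (a : Orientation) (i j : Fin N) (y : WordSpace K (Fin N)) :
    juxt ((weights q N).cap a i j) y = (if i = j then capWeight q N a i else 0) • y := by
  rw [weights, map_smul, LinearMap.smul_apply, juxt_nil_left]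

@[simp]
theorem juxt_cap_right (a : Orientation) (i j : Fin N) (y : WordSpace K (Fin N)) :
    juxt y ((weights q N).cap a i j) = (if i = j then capWeight q N a i else 0) • y := by
  rw [weights, map_smul, juxt_nil_right]

@[simp]
theorem weights_cross (o : Bool) (a b : Orientation) (i j : Fin N) :
    (weights q N).cross o a b i j = crossWeight q N o a b i j := rfl

theorem pass_comm (o : Bool) (i j : Fin N) : pass q N o i j = pass q N o j i := by
  simp [pass, eq_comm]

variable (hq : q ≠ 0)
include hq

theorem kap_ne_zero (n : ℕ) : kap q N n ≠ 0 :=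
  mul_ne_zero (pow_ne_zero _ hq) (inv_ne_zero (pow_ne_zero _ hq))

/-- A strand that crosses one leg of a maximum may cross the other leg instead. -/
theorem half_cap (o : Bool) {a b : Orientation} (h : a ≠ b) (c : Orientation) :
    (weights q N).SameMatrix
      (comp (tensor (id [a]) (cross (!o) c b) :) (tensor (cap h) (id [c]) :))
      (comp (tensor (cross o a c) (id [b]) :) (tensor (id [c]) (cap h) :)) := by
  refine Weights.sameMatrix_of_words _ fun w hw => ?_
  obtain ⟨i, j, k, rfl⟩ := List.length_eq_three.1 hw
  have hk : ∀ i : Fin N, kap q N i ≠ 0 := fun i => kap_ne_zero hq i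
  have hp := pass_comm (q := q) (N := N)
  have h1 : j = i ↔ i = j := eq_comm
  have h2 : k = j ↔ j = k := eq_comm
  have h3 : k = i ↔ i = k := eq_comm
  cases a <;> cases b <;> first | exact absurd rfl h | skip
  all_goals cases c
  all_goals by_cases hij : i = j <;> by_cases hjk : j = k <;> by_cases hik : i = k
  all_goals
    simp [crossWeight, capWeight, smul_smul, hij, hjk, hik, hp, h2, hk]

/-- A strand that crosses one leg of a minimum may cross the other leg instead. -/
theorem half_cup (o : Bool) {a b : Orientation} (h : a ≠ b) (c : Orientation) :
    (weights q N).SameMatrix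
      (comp (tensor (id [c]) (cup h) :) (tensor (cross (!o) c a) (id [b]) :))
      (comp (tensor (cup h) (id [c]) :) (tensor (id [a]) (cross o b c) :)) := by
  refine Weights.sameMatrix_of_words _ fun w hw => ?_
  obtain ⟨k, rfl⟩ := List.length_eq_one_iff.1 hw
  have hk : ∀ i : Fin N, kap q N i ≠ 0 := fun i => kap_ne_zero hq i
  have hp := pass_comm (q := q) (N := N)
  cases a <;> cases b <;> first | exact absurd rfl h | skip
  all_goals cases c
  all_goals simp [crossWeight, smul_smul, Finset.smul_sum, Finset.sum_add_distrib, hp]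
  all_goals
    refine Finset.sum_congr rfl fun x _ => ?_
    congr 1
    field_simp [hk k, hk x]

theorem zigzag_left {a b : Orientation} (h : a ≠ b) :
    (weights q N).SameMatrix
      (comp (tensor (id [a]) (cup h.symm) :) (tensor (cap h) (id [a]) :)) (id [a]) := by
  refine Weights.sameMatrix_of_words _ fun w hw => ?_
  obtain ⟨k, rfl⟩ := List.length_eq_one_iff.1 hw
  have hk : ∀ i : Fin N, kap q N i ≠ 0 := fun i => kap_ne_zero hq i
  cases a <;> cases b <;> first | exact absurd rfl h | skip
  all_goals simp [capWeight, smul_smul, hk]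

theorem zigzag_right {a b : Orientation} (h : a ≠ b) :
    (weights q N).SameMatrix
      (comp (tensor (cup h) (id [a]) :) (tensor (id [a]) (cap h.symm) :)) (id [a]) := by
  refine Weights.sameMatrix_of_words _ fun w hw => ?_
  obtain ⟨k, rfl⟩ := List.length_eq_one_iff.1 hw
  have hk : ∀ i : Fin N, kap q N i ≠ 0 := fun i => kap_ne_zero hq i
  cases a <;> cases b <;> first | exact absurd rfl h | skip
  all_goals simp [capWeight, smul_smul, hk]

omit hq in
theorem kap_succ (n : ℕ) : kap q N (n + 1) = q ^ 2 * kap q N n := by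
  simp only [kap]
  ring

/-- The terms telescope: `(q⁻¹ - q) κ_y = q⁻¹ κ_y - q⁻¹ κ_{y+1}`. -/
theorem sum_ico_kap {x b : ℕ} (h : x < b) :
    (q⁻¹ - q) * ∑ y ∈ Finset.Ico (x + 1) b, kap q N y = q * kap q N x - q⁻¹ * kap q N b := by
  induction b, h using Nat.le_induction with
  | base =>
    rw [Finset.Ico_self, Finset.sum_empty, kap_succ]
    field_simp
    ring
  | succ b h ih =>
    rw [Finset.sum_Ico_succ_top h, mul_add, ih, kap_succ]
    field_simp
    ring

/-- The terms telescope: `(q⁻¹ - q) κ_y⁻¹ = q κ_{y+1}⁻¹ - q κ_y⁻¹`. -/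
theorem sum_ico_kap_inv {x b : ℕ} (h : x < b) :
    (q⁻¹ - q) * ∑ y ∈ Finset.Ico (x + 1) b, (kap q N y)⁻¹ =
      q * (kap q N b)⁻¹ - q⁻¹ * (kap q N x)⁻¹ := by
  induction b, h using Nat.le_induction with
  | base =>
    rw [Finset.Ico_self, Finset.sum_empty, kap_succ]
    field_simp
    ring
  | succ b h ih =>
    have := kap_ne_zero (N := N) hq b
    rw [Finset.sum_Ico_succ_top h, mul_add, ih, kap_succ]
    field_simp
    ring

omit hq in
theorem sum_between (f : ℕ → K) (x b : Fin N) :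
    (∑ y : Fin N, if x < y ∧ y < b then f y else 0) =
      ∑ y ∈ Finset.Ico (x + 1 : ℕ) b, f y := by
  simp only [Fin.lt_def]
  rw [Fin.sum_univ_eq_sum_range (fun n => if (x : ℕ) < n ∧ n < b then f n else 0),
    ← Finset.sum_filter]
  congr 1
  ext n
  have := b.2
  simp
  omega

/-- The vanishing of the coefficients off the diagonal in the second Reidemeister move for strands
of opposite orientations, the left one being upward. -/
theorem sum_turn_up (o : Bool) (i z : Fin N) :
    pass q N (!o) i i * turn q N o i z +
      turn q N (!o) z i * kap q N i * (kap q N z)⁻¹ * pass q N o z z +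
      ∑ y, turn q N (!o) y i * kap q N i * (kap q N y)⁻¹ * turn q N o y z = 0 := by
  have hk : ∀ i : Fin N, kap q N i ≠ 0 := fun i => kap_ne_zero hq i
  cases o
  · have : ∀ y : Fin N, turn q N true y i * kap q N i * (kap q N y)⁻¹ * turn q N false y z =
        -((q⁻¹ - q) ^ 2 * kap q N i) * if i < y ∧ y < z then (kap q N y)⁻¹ else 0 := by
      intro y
      by_cases h1 : i < y <;> by_cases h2 : y < z <;> simp [turn, h1, h2]
      ring
    simp only [Bool.not_false, this, ← Finset.mul_sum, sum_between fun y => (kap q N y)⁻¹]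
    by_cases h : i < z
    · have := sum_ico_kap_inv (N := N) hq h
      simp only [pass, turn, h, if_true, Bool.false_eq_true, if_false]
      linear_combination (-(q⁻¹ - q) * kap q N i) * this +
        (q⁻¹ - q) * q⁻¹ * mul_inv_cancel₀ (hk i)
    · rw [Finset.Ico_eq_empty (by rw [Fin.lt_def] at h; omega)]
      simp [turn, h]
  · have : ∀ y : Fin N, turn q N false y i * kap q N i * (kap q N y)⁻¹ * turn q N true y z =
        -((q⁻¹ - q) ^ 2 * kap q N i) * if z < y ∧ y < i then (kap q N y)⁻¹ else 0 := by
      intro y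
      by_cases h1 : z < y <;> by_cases h2 : y < i <;> simp [turn, h1, h2]
      ring
    simp only [Bool.not_true, this, ← Finset.mul_sum, sum_between fun y => (kap q N y)⁻¹]
    by_cases h : z < i
    · have := sum_ico_kap_inv (N := N) hq h
      simp only [pass, turn, h, if_true, Bool.false_eq_true, if_false]
      linear_combination (-(q⁻¹ - q) * kap q N i) * this -
        (q⁻¹ - q) * q * mul_inv_cancel₀ (hk i)
    · rw [Finset.Ico_eq_empty (by rw [Fin.lt_def] at h; omega)]
      simp [turn, h]

/-- The vanishing of the coefficients off the diagonal in the second Reidemeister move for strands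
of opposite orientations, the left one being downward. -/
theorem sum_turn_down (o : Bool) (i z : Fin N) :
    pass q N (!o) i i * (turn q N o z i * kap q N i * (kap q N z)⁻¹) +
      turn q N (!o) i z * pass q N o z z +
      ∑ y, turn q N (!o) i y * (turn q N o z y * kap q N y * (kap q N z)⁻¹) = 0 := by
  have hk : ∀ i : Fin N, kap q N i ≠ 0 := fun i => kap_ne_zero hq i
  cases o
  · have : ∀ y : Fin N, turn q N true i y * (turn q N false z y * kap q N y * (kap q N z)⁻¹) =
        -((q⁻¹ - q) ^ 2 * (kap q N z)⁻¹) * if z < y ∧ y < i then kap q N y else 0 := by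
      intro y
      by_cases h1 : z < y <;> by_cases h2 : y < i <;> simp [turn, h1, h2]
      ring
    simp only [Bool.not_false, this, ← Finset.mul_sum, sum_between fun y => kap q N y]
    by_cases h : z < i
    · have := sum_ico_kap (N := N) hq h
      simp only [pass, turn, h, if_true, Bool.false_eq_true, if_false]
      linear_combination (-(q⁻¹ - q) * (kap q N z)⁻¹) * this -
        (q⁻¹ - q) * q * mul_inv_cancel₀ (hk z)
    · rw [Finset.Ico_eq_empty (by rw [Fin.lt_def] at h; omega)]
      simp [turn, h]
  · have : ∀ y : Fin N, turn q N false i y * (turn q N true z y * kap q N y * (kap q N z)⁻¹) =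
        -((q⁻¹ - q) ^ 2 * (kap q N z)⁻¹) * if i < y ∧ y < z then kap q N y else 0 := by
      intro y
      by_cases h1 : i < y <;> by_cases h2 : y < z <;> simp [turn, h1, h2]
      ring
    simp only [Bool.not_true, this, ← Finset.mul_sum, sum_between fun y => kap q N y]
    by_cases h : i < z
    · have := sum_ico_kap (N := N) hq h
      simp only [pass, turn, h, if_true, Bool.false_eq_true, if_false]
      linear_combination (-(q⁻¹ - q) * (kap q N z)⁻¹) * this +
        (q⁻¹ - q) * q⁻¹ * mul_inv_cancel₀ (hk z)
    · rw [Finset.Ico_eq_empty (by rw [Fin.lt_def] at h; omega)]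
      simp [turn, h]

theorem reidemeister_two (o : Bool) (a b : Orientation) :
    (weights q N).SameMatrix (comp (cross o a b) (cross (!o) b a)) (id [a, b]) := by
  refine Weights.sameMatrix_of_words _ fun w hw => ?_
  obtain ⟨i, j, rfl⟩ := List.length_eq_two.1 hw
  have hp : ∀ i j : Fin N, pass q N o i j * pass q N (!o) j i = 1 := by
    intro i j
    cases o <;> by_cases h : i = j <;> simp [pass, h, eq_comm, hq]
  have hp' : ∀ i j : Fin N, pass q N (!o) i j * pass q N o j i = 1 := by
    intro i j
    rw [mul_comm, hp]
  cases a <;> cases b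
  · rcases lt_trichotomy i j with h | rfl | h
    · cases o <;> simp [crossWeight, pass, turn, h, h.ne, h.ne', h.not_gt]; try module
    · cases o <;> simp [crossWeight, pass, turn, hq, smul_smul]
    · cases o <;> simp [crossWeight, pass, turn, h, h.ne, h.ne', h.not_gt]; try module
  · by_cases h : i = j
    · subst h
      have := sum_turn_up (N := N) hq o i
      simp only [add_assoc] at this
      simp only [Weights.col_comp, Weights.col_cross, weights_cross, crossWeight, if_true,
        Bool.not_not, map_add, map_smul, map_sum, extend_word, smul_add, smul_smul, hp', one_smul,
        Finset.smul_sum, Finset.sum_add_distrib, Weights.col_id_two]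
      rw [Finset.sum_comm]
      simp only [← Finset.sum_smul, add_assoc, ← Finset.sum_add_distrib, ← add_smul, this,
        zero_smul, Finset.sum_const_zero, add_zero]
    · simp [crossWeight, smul_smul, h, Ne.symm h, hp']
  · by_cases h : i = j
    · subst h
      have := sum_turn_down (N := N) hq o i
      simp only [add_assoc] at this
      simp only [Weights.col_comp, Weights.col_cross, weights_cross, crossWeight, if_true,
        Bool.not_not, map_add, map_smul, map_sum, extend_word, smul_add, smul_smul, hp', one_smul,
        Finset.smul_sum, Finset.sum_add_distrib, Weights.col_id_two]
      rw [Finset.sum_comm]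
      simp only [← Finset.sum_smul, add_assoc, ← Finset.sum_add_distrib, ← add_smul, this,
        zero_smul, Finset.sum_const_zero, add_zero]
    · simp [crossWeight, smul_smul, h, Ne.symm h, hp']
  · rcases lt_trichotomy i j with h | rfl | h
    · cases o <;> simp [crossWeight, pass, turn, h, h.ne, h.ne', h.not_gt]; try module
    · cases o <;> simp [crossWeight, pass, turn, hq, smul_smul]
    · cases o <;> simp [crossWeight, pass, turn, h, h.ne, h.ne', h.not_gt]; try module

end Gl
end Homfly

namespace Homfly
namespace Gl
open Homfly.Diagram Homfly.Orientation

/-! ### Invariance of the `gl(N)` state sum under the moves -/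

variable {K : Type*} [Field K] {q : K} {N : ℕ} (hq : q ≠ 0)
include hq

/-- The passage of a strand across a maximum is half of it together with the second Reidemeister
move. -/
theorem slide_cap (o : Bool) {a b : Orientation} (h : a ≠ b) (c : Orientation) :
    (weights q N).SameMatrix (tensor (cap h) (id [c]) :)
      (comp (tensor (id [a]) (cross o b c) :)
        (comp (tensor (cross o a c) (id [b]) :) (tensor (id [c]) (cap h) :))) := by
  have C := (weights q N).sameMatrix_monoidalCongruence
  have h1 : (weights q N).SameMatrix
      (comp (tensor (id [a]) (cross o b c) :) (tensor (id [a]) (cross (!o) c b) :))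
      (id [a, b, c]) :=
    C.trans (C.symm (C.tensor_comp _ _ _ _)) (C.trans
      (C.tensor_congr (C.id_comp _) (reidemeister_two hq o b c)) (C.tensor_id _ _))
  exact C.trans (C.symm (C.id_comp _)) (C.trans (C.comp_congr (C.symm h1) (C.refl _))
    (C.trans (C.comp_assoc _ _ _) (C.comp_congr (C.refl _) (half_cap hq o h c))))

theorem slide_cup (o : Bool) {a b : Orientation} (h : a ≠ b) (c : Orientation) :
    (weights q N).SameMatrix (tensor (id [c]) (cup h) :)
      (comp (tensor (cup h) (id [c]) :)
        (comp (tensor (id [a]) (cross o b c) :) (tensor (cross o a c) (id [b]) :))) := by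
  have C := (weights q N).sameMatrix_monoidalCongruence
  have h2 := reidemeister_two (N := N) hq (!o) c a
  rw [Bool.not_not] at h2
  have h1 : (weights q N).SameMatrix
      (comp (tensor (cross (!o) c a) (id [b]) :) (tensor (cross o a c) (id [b]) :))
      (id [c, a, b]) :=
    C.trans (C.symm (C.tensor_comp _ _ _ _)) (C.trans
      (C.tensor_congr h2 (C.id_comp _)) (C.tensor_id _ _))
  exact C.trans (C.symm (C.comp_id _)) (C.trans (C.comp_congr (C.refl _) (C.symm h1))
    (C.trans (C.symm (C.comp_assoc _ _ _)) (C.trans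
      (C.comp_congr (half_cup hq o h c) (C.refl _)) (C.comp_assoc _ _ _))))

theorem action_isBraided : (weights q N).action.IsBraided where
  zigzag_left := zigzag_left hq
  zigzag_right := zigzag_right hq
  reidemeister_two := reidemeister_two hq
  slide_cap := slide_cap hq
  slide_cup := slide_cup hq

set_option maxHeartbeats 1000000 in
/-- The Yang-Baxter equation for the `R`-matrix. -/
theorem yang_baxter (o : Bool) :
    (weights q N).SameMatrix
      (comp (tensor (cross o up up) (id [up]) :)
        (comp (tensor (id [up]) (cross o up up) :) (tensor (cross o up up) (id [up]) :)))
      (comp (tensor (id [up]) (cross o up up) :)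
        (comp (tensor (cross o up up) (id [up]) :) (tensor (id [up]) (cross o up up) :))) := by
  refine Weights.sameMatrix_of_words _ fun w hw => ?_
  obtain ⟨i, j, k, rfl⟩ := List.length_eq_three.1 hw
  clear hw
  have tri : ∀ i j : Fin N, (i < j ∧ ¬ j < i ∧ i ≠ j ∧ j ≠ i) ∨ i = j ∨
      (j < i ∧ ¬ i < j ∧ i ≠ j ∧ j ≠ i) := fun i j => by omega
  rcases tri i j with h1 | h1 | h1 <;> rcases tri j k with h2 | h2 | h2 <;>
    rcases tri i k with h3 | h3 | h3 <;> try (exfalso; omega)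
  all_goals cases o
  all_goals
    simp [crossWeight, pass, turn, h1, h2, h3]
  all_goals
    first
      | module
      | (match_scalars <;> field_simp; ring)

/-- The third Reidemeister move for all orientations follows from the Yang-Baxter equation by
rotating crossings. -/
theorem reidemeister_three (o : Bool) (a b c : Orientation) :
    (weights q N).SameMatrix
        (comp (tensor (cross o a b) (id [c]) :)
          (comp (tensor (id [b]) (cross o a c) :) (tensor (cross o b c) (id [a]) :)))
        (comp (tensor (id [a]) (cross o b c) :)
          (comp (tensor (cross o a c) (id [b]) :) (tensor (id [c]) (cross o a b) :))) := by
  have key := DiagramAction.Slides.cross_of_all_up (action_isBraided (N := N) hq)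
    (fun o p u x => by
      have := (weights q N).action.slice_congr (yang_baxter hq o) p u x
      simpa only [DiagramAction.slice_comp, DiagramAction.slice_tensor_left,
        DiagramAction.slice_tensor_right, DiagramAction.slide, List.cons_append, List.nil_append,
        List.append_assoc] using this) o o a b c
  refine ⟨rfl, rfl, funext fun w => ?_⟩
  have h := key [] [] (word w)
  simp only [DiagramAction.slide, List.append_nil, List.nil_append] at h
  have h' : (weights q N).action.slice []
        (comp (tensor (cross o a b) (id [c]) :)
          (comp (tensor (id [b]) (cross o a c) :) (tensor (cross o b c) (id [a]) :))) [] (word w) =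
      (weights q N).action.slice []
        (comp (tensor (id [a]) (cross o b c) :)
          (comp (tensor (cross o a c) (id [b]) :) (tensor (id [c]) (cross o a b) :)))
        [] (word w) := by
    simpa only [DiagramAction.slice_comp, DiagramAction.slice_tensor_left,
      DiagramAction.slice_tensor_right, List.append_nil, List.nil_append] using h
  rw [DiagramAction.slice_nil, DiagramAction.slice_nil] at h'
  simpa only [Weights.action, extend_word] using h'

theorem sum_range_kap (n : ℕ) :
    (q⁻¹ - q) * ∑ y ∈ Finset.range n, kap q N y = (q ^ N)⁻¹ - q⁻¹ * kap q N n := by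
  induction n with
  | zero => simp [kap, hq]
  | succ n ih =>
    rw [Finset.sum_range_succ, mul_add, ih, kap_succ]
    field_simp
    ring

theorem sum_range_kap_inv (n : ℕ) :
    (q⁻¹ - q) * ∑ y ∈ Finset.range n, (kap q N y)⁻¹ = q * (kap q N n)⁻¹ - q ^ N := by
  induction n with
  | zero =>
    simp [kap]
    field_simp
    ring
  | succ n ih =>
    have := kap_ne_zero (N := N) hq n
    rw [Finset.sum_range_succ, mul_add, ih, kap_succ]
    field_simp
    ring

theorem kap_self : kap q N N = q * q ^ N := by
  rw [kap]
  field_simp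
  ring

omit hq in
theorem sum_below (f : ℕ → K) (i : Fin N) :
    (∑ y : Fin N, if y < i then f y else 0) = ∑ y ∈ Finset.range i, f y := by
  simp only [Fin.lt_def]
  rw [Fin.sum_univ_eq_sum_range (fun n => if n < (i : ℕ) then f n else 0), ← Finset.sum_filter]
  congr 1
  ext n
  have := i.2
  simp
  omega

omit hq in
theorem sum_above (f : ℕ → K) (i : Fin N) :
    (∑ y : Fin N, if i < y then f y else 0) = ∑ y ∈ Finset.Ico (i + 1 : ℕ) N, f y := by
  simp only [Fin.lt_def]
  rw [Fin.sum_univ_eq_sum_range (fun n => if (i : ℕ) < n then f n else 0), ← Finset.sum_filter]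
  congr 1
  ext n
  simp
  omega

/-- The partial trace of a crossing of upward strands, closed on the right. -/
theorem sum_turn_kap (o : Bool) (i : Fin N) :
    pass q N o i i * kap q N i + ∑ x, turn q N o i x * kap q N x =
      if o then (q ^ N)⁻¹ else q ^ N := by
  cases o
  · simp only [pass, turn, if_true, ite_mul, zero_mul, Bool.false_eq_true, if_false,
      sum_above fun y => -(q⁻¹ - q) * kap q N y]
    rw [← Finset.mul_sum, neg_mul, sum_ico_kap hq i.2, kap_self hq]
    field_simp
    ring
  · simp only [pass, turn, if_true, ite_mul, zero_mul, sum_below fun y => (q⁻¹ - q) * kap q N y]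
    rw [← Finset.mul_sum, sum_range_kap hq]
    ring

/-- The partial trace of a crossing of upward strands, closed on the left. -/
theorem sum_turn_kap_inv (o : Bool) (i : Fin N) :
    (kap q N i)⁻¹ * pass q N o i i + ∑ x : Fin N, (kap q N x)⁻¹ * turn q N o x i =
      if o then (q ^ N)⁻¹ else q ^ N := by
  have := kap_ne_zero (N := N) hq i
  cases o
  · simp only [pass, turn, if_true, mul_ite, mul_zero, Bool.false_eq_true, if_false,
      sum_below fun y => (kap q N y)⁻¹ * -(q⁻¹ - q)]
    rw [← Finset.sum_mul, mul_comm _ (-(q⁻¹ - q)), neg_mul, sum_range_kap_inv hq]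
    ring
  · simp only [pass, turn, if_true, mul_ite, mul_zero,
      sum_above fun y => (kap q N y)⁻¹ * (q⁻¹ - q)]
    rw [← Finset.sum_mul, mul_comm _ (q⁻¹ - q), sum_ico_kap_inv hq i.2, kap_self hq]
    field_simp
    ring

/-- A curl to the right is a scalar. -/
theorem col_curl_right (o : Bool) {a b : Orientation} (h : a ≠ b) (i : Fin N) :
    (weights q N).col
      (comp (tensor (id [a]) (cup h) :)
          (comp (tensor (cross o a a) (id [b]) :) (tensor (id [a]) (cap h) :))) [i] =
      (if o then (q ^ N)⁻¹ else q ^ N) • word [i] := by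
  have h1 := sum_turn_kap (N := N) hq o i
  have h2 := sum_turn_kap_inv (N := N) hq o i
  generalize (if o = true then (q ^ N)⁻¹ else q ^ N) = c at h1 h2 ⊢
  cases a <;> cases b <;> first | exact absurd rfl h | skip
  · simp [crossWeight, capWeight, smul_smul, Finset.sum_add_distrib]
    rw [← Finset.sum_smul, ← add_smul, h1]
  · simp [crossWeight, capWeight, smul_smul, Finset.sum_add_distrib]
    rw [← Finset.sum_smul, ← add_smul, h2]

/-- A curl to the left is a scalar. -/
theorem col_curl_left (o : Bool) {a b : Orientation} (h : a ≠ b) (i : Fin N) :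
    (weights q N).col
        (comp (tensor (cup h.symm) (id [a]) :)
          (comp (tensor (id [b]) (cross o a a) :) (tensor (cap h.symm) (id [a]) :))) [i] =
      (if o then (q ^ N)⁻¹ else q ^ N) • word [i] := by
  have h1 := sum_turn_kap (N := N) hq o i
  have h2 := sum_turn_kap_inv (N := N) hq o i
  generalize (if o = true then (q ^ N)⁻¹ else q ^ N) = c at h1 h2 ⊢
  cases a <;> cases b <;> first | exact absurd rfl h | skip
  · simp [crossWeight, capWeight, smul_smul, Finset.sum_add_distrib]
    rw [← Finset.sum_smul, ← add_smul, h2]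
  · simp [crossWeight, capWeight, smul_smul, Finset.sum_add_distrib]
    rw [← Finset.sum_smul, ← add_smul, h1]

theorem reidemeister_one (o : Bool) {a b : Orientation} (h : a ≠ b) :
    (weights q N).SameMatrix
        (comp (tensor (id [a]) (cup h) :)
          (comp (tensor (cross o a a) (id [b]) :) (tensor (id [a]) (cap h) :)))
        (comp (tensor (cup h.symm) (id [a]) :)
          (comp (tensor (id [b]) (cross o a a) :) (tensor (cap h.symm) (id [a]) :))) := by
  refine Weights.sameMatrix_of_words _ fun w hw => ?_
  obtain ⟨i, rfl⟩ := List.length_eq_one_iff.1 hw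
  exact (col_curl_right hq o h i).trans (col_curl_left hq o h i).symm

/-- The matrices of the vector representation of the quantum group of `gl(N)` depend only on the
tangle. -/
theorem sameMatrix_of_isotopic {s t s' t' : List Orientation} {f : Diagram s t}
    {g : Diagram s' t'} (h : Isotopic f g) : (weights q N).SameMatrix f g := by
  have C := (weights q N).sameMatrix_monoidalCongruence
  induction h with
  | refl f => exact C.refl f
  | symm _ h => exact C.symm h
  | trans _ _ h h' => exact C.trans h h'
  | comp_congr _ _ h h' => exact C.comp_congr h h'
  | tensor_congr _ _ h h' => exact C.tensor_congr h h'
  | id_comp f => exact C.id_comp f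
  | comp_id f => exact C.comp_id f
  | comp_assoc f g h => exact C.comp_assoc f g h
  | tensor_id s t => exact C.tensor_id s t
  | tensor_comp f g f' g' => exact C.tensor_comp f g f' g'
  | unit_tensor f => exact C.unit_tensor f
  | tensor_unit f => exact C.tensor_unit f
  | tensor_assoc f g h => exact C.tensor_assoc f g h
  | zigzag_left h => exact zigzag_left hq h
  | zigzag_right h => exact zigzag_right hq h
  | reidemeister_two o a b => exact reidemeister_two hq o a b
  | reidemeister_three o a b c => exact reidemeister_three hq o a b c
  | slide_cap o h c => exact slide_cap hq o h c
  | slide_cup o h c => exact slide_cup hq o h c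
  | reidemeister_one o h => exact reidemeister_one hq o h

/-- A circle of either orientation is the quantum integer `[N]`. -/
theorem col_circle {a b : Orientation} (h : a ≠ b) (hz : q - q⁻¹ ≠ 0) :
    (weights q N).col (comp (cup h) (cap h)) [] =
      ((q - q⁻¹)⁻¹ * (q ^ N - (q ^ N)⁻¹)) • word [] := by
  have h1 := sum_range_kap (N := N) hq N
  have h2 := sum_range_kap_inv (N := N) hq N
  rw [kap_self hq] at h1 h2
  cases a <;> cases b <;> first | exact absurd rfl h | skip
  · simp [weights, cupWeight, capWeight]
    rw [← Finset.sum_smul, Fin.sum_univ_eq_sum_range (kap q N)]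
    congr 1
    rw [eq_inv_mul_iff_mul_eq₀ hz]
    linear_combination -h1 + q ^ N * inv_mul_cancel₀ hq
  · simp [weights, cupWeight, capWeight]
    rw [← Finset.sum_smul, Fin.sum_univ_eq_sum_range fun n => (kap q N n)⁻¹]
    congr 1
    rw [eq_inv_mul_iff_mul_eq₀ hz]
    rw [mul_inv, mul_inv_cancel_left₀ hq] at h2
    linear_combination -h2

omit hq in
theorem col_skein (i j : Fin N) :
    (weights q N).col (cross true up up) [i, j] - (weights q N).col (cross false up up) [i, j] =
      (q⁻¹ - q) • word [i, j] := by
  rcases lt_trichotomy i j with h | rfl | h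
  · simp [crossWeight, pass, turn, h, h.ne, h.not_gt]
    module
  · simp [crossWeight, pass, turn, sub_smul]
  · simp [crossWeight, pass, turn, h, h.ne', h.not_gt]

end Gl
end Homfly

namespace Homfly
open Homfly.Diagram Homfly.Orientation

/-! ### Specialization at `β = N` -/

section Specialization

variable {K : Type*} [Field K] {x : K} (N : ℕ) (hx : x ≠ 0) (ev : BaseRing →+* K)
  {s t : List Orientation}

/-- The matrix of a tangle. -/
noncomputable def tangleCol (T : Tangle s t) : List (Fin N) → WordSpace K (Fin N) :=
  Quotient.lift (Gl.weights x N).col (fun _ _ h => (Gl.sameMatrix_of_isotopic hx h).2.2) T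

/-- The matrix of a formal linear combination of tangles, with coefficients specialized along
`ev`. -/
noncomputable def linCol (w : List (Fin N)) : LinTangle s t →+ WordSpace K (Fin N) :=
  Finsupp.liftAddHom fun T =>
    ((AddMonoidHom.flip (smulAddHom K (WordSpace K (Fin N)))) (tangleCol N hx T w)).comp
      ev.toAddMonoidHom

theorem linCol_single (w : List (Fin N)) (T : Tangle s t) (p : BaseRing) :
    linCol N hx ev w (Finsupp.single T p) = ev p • tangleCol N hx T w := by
  rw [linCol, Finsupp.liftAddHom_apply_single]
  rfl

theorem linCol_smul (w : List (Fin N)) (c : BaseRing) (z : LinTangle s t) :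
    linCol N hx ev w (c • z) = ev c • linCol N hx ev w z := by
  induction z using Finsupp.induction_linear with
  | zero => rw [smul_zero, map_zero, smul_zero]
  | add y z hy hz => rw [smul_add, map_add, hy, hz, map_add, smul_add]
  | single T p =>
    rw [Finsupp.smul_single, linCol_single, linCol_single, smul_eq_mul, map_mul, mul_smul]

theorem linCol_diag (w : List (Fin N)) (f : Diagram s t) :
    linCol N hx ev w (diag f) = (Gl.weights x N).col f w := by
  rw [diag, linCol_single, map_one, one_smul]
  rfl

theorem linCol_eq_zero (z : LinTangle s t) {w : List (Fin N)} (hw : w.length ≠ s.length) :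
    linCol N hx ev w z = 0 := by
  induction z using Finsupp.induction_linear with
  | zero => exact map_zero _
  | add y z hy hz => rw [map_add, hy, hz, add_zero]
  | single T p =>
    rw [linCol_single]
    induction T using Quotient.inductionOn with | h f => ?_
    exact smul_eq_zero_of_right _ ((Gl.weights x N).col_eq_zero f w hw)

/-- The matrix of a plugged combination is obtained linearly from that of the combination; so it
vanishes with the latter. -/
theorem linCol_plug {y z : List Orientation} (u v : List Orientation)
    (f : Tangle s (u ++ y ++ v)) (g : Tangle (u ++ z ++ v) t) (r : LinTangle y z)
    (w : List (Fin N)) : linCol N hx ev w (plug u v f g r) =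
      extend (tangleCol N hx g) (extend (fun w' =>
        juxt (juxt ((Gl.weights x N).col (.id u) ((w'.take (u ++ y).length).take u.length))
          (linCol N hx ev ((w'.take (u ++ y).length).drop u.length) r))
          ((Gl.weights x N).col (.id v) (w'.drop (u ++ y).length)))
        (tangleCol N hx f w)) := by
  induction r using Finsupp.induction_linear with
  | zero => simp only [map_zero, LinearMap.zero_apply, extend_zero]
  | add r r' h h' =>
    rw [map_add, map_add, h, h', ← map_add, ← LinearMap.add_apply, ← extend_add]
    simp only [map_add, LinearMap.add_apply]
  | single T p =>
    have h : plug u v f g (Finsupp.single T p) = Finsupp.single (Tangle.comp (Tangle.comp f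
        (Tangle.tensor (Tangle.tensor (Tangle.id u) T) (Tangle.id v))) g) p :=
      Finsupp.mapDomain_single
    simp only [h, linCol_single, map_smul, LinearMap.smul_apply, extend_smul]
    congr 1
    induction T using Quotient.inductionOn with | h T => ?_
    induction f using Quotient.inductionOn with | h f => ?_
    induction g using Quotient.inductionOn with | h g => ?_
    change (Gl.weights x N).col (.comp (.comp f (.tensor (.tensor (.id u) T) (.id v))) g) w = _
    simp only [Weights.col]
    rfl

/-- The state sum of `gl(N)` satisfies the defining relations of `Br(β)` at `β = N`. -/
theorem linCol_relator (hz : x - x⁻¹ ≠ 0) (hq : ev q = x) (hq' : ev qInv = x⁻¹)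
    (hT : ev (qBeta 1) = x ^ N) (hT' : ev (qBeta (-1)) = (x ^ N)⁻¹)
    (hβ : ev betaNumber = (x - x⁻¹)⁻¹ * (x ^ N - (x ^ N)⁻¹)) {r : LinTangle s t}
    (hr : Relator s t r) (w : List (Fin N)) : linCol N hx ev w r = 0 := by
  by_cases hw : w.length = s.length
  · cases hr with
    | skein =>
      obtain ⟨i, j, rfl⟩ := List.length_eq_two.1 hw
      rw [map_sub, map_sub, linCol_smul, linCol_diag, linCol_diag, linCol_diag, Gl.col_skein,
        map_sub, hq, hq', Weights.col_id_two, sub_self]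
    | circle h =>
      obtain rfl := List.length_eq_zero_iff.1 hw
      rw [map_sub, linCol_smul, linCol_diag, linCol_diag, Gl.col_circle hx h hz, hβ,
        Weights.col_id_nil, sub_self]
    | curl_right o h =>
      obtain ⟨i, rfl⟩ := List.length_eq_one_iff.1 hw
      rw [map_sub, linCol_smul, linCol_diag, linCol_diag, Weights.col_id_one]
      refine sub_eq_zero.2 ((Gl.col_curl_right hx o h i).trans ?_)
      cases o
      · exact congrArg (· • word [i]) hT.symm
      · exact congrArg (· • word [i]) hT'.symm
    | curl_left o h =>
      obtain ⟨i, rfl⟩ := List.length_eq_one_iff.1 hw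
      rw [map_sub, linCol_smul, linCol_diag, linCol_diag, Weights.col_id_one]
      refine sub_eq_zero.2 ((Gl.col_curl_left hx o h.symm i).trans ?_)
      cases o
      · exact congrArg (· • word [i]) hT.symm
      · exact congrArg (· • word [i]) hT'.symm
  · exact linCol_eq_zero N hx ev r hw

theorem linCol_relatorIdeal (hr : ∀ {y z : List Orientation} {r : LinTangle y z},
    Relator y z r → ∀ w, linCol N hx ev w r = 0) {z : LinTangle s t}
    (hz : z ∈ relatorIdeal s t) (w : List (Fin N)) : linCol N hx ev w z = 0 := by
  induction hz using Submodule.span_induction with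
  | zero => exact map_zero _
  | add y z _ _ hy hz => rw [map_add, hy, hz, add_zero]
  | smul c z _ hz => rw [linCol_smul, hz, smul_zero]
  | mem z hz =>
    obtain ⟨y, z, u, v, f, g, r, h, rfl⟩ := hz
    simp only [linCol_plug, hr h, map_zero, LinearMap.zero_apply, extend_zero]

end Specialization

/-- The specialization `q^β ↦ q^N` of the ground ring. -/
noncomputable def evalBeta (N : ℕ) : BaseRing →+* RatFunc ℂ :=
  LaurentPolynomial.eval₂ (RingHom.id _)
    (Units.mk0 (RatFunc.X ^ N) (pow_ne_zero N RatFunc.X_ne_zero))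

theorem evalBeta_C (N : ℕ) (a : RatFunc ℂ) : evalBeta N (LaurentPolynomial.C a) = a :=
  LaurentPolynomial.eval₂_C _ _ _

theorem evalBeta_qBeta (N : ℕ) (m : ℤ) : evalBeta N (qBeta m) = (RatFunc.X ^ N) ^ m := by
  rw [evalBeta, qBeta, LaurentPolynomial.eval₂_T, Units.val_zpow_eq_zpow_val, Units.val_mk0]

theorem evalBeta_betaNumber (N : ℕ) : evalBeta N betaNumber =
    (RatFunc.X - RatFunc.X⁻¹)⁻¹ * (RatFunc.X ^ N - (RatFunc.X ^ N)⁻¹) := by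
  rw [betaNumber, map_mul, map_sub, evalBeta_C, evalBeta_qBeta, evalBeta_qBeta,
    zpow_one, zpow_neg_one]

theorem ratFunc_X_pow_injective :
    Function.Injective fun N : ℕ => (RatFunc.X : RatFunc ℂ) ^ N := by
  intro m n h
  simp only [← RatFunc.algebraMap_X, ← map_pow] at h
  have := congrArg Polynomial.natDegree (RatFunc.algebraMap_injective ℂ h)
  simpa using this

theorem ratFunc_X_sub_inv_ne_zero : (RatFunc.X : RatFunc ℂ) - RatFunc.X⁻¹ ≠ 0 := by
  intro h
  have h1 : (RatFunc.X : RatFunc ℂ) ^ 2 = RatFunc.X ^ 0 := by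
    rw [pow_zero, sq]
    nth_rw 2 [sub_eq_zero.1 h]
    exact mul_inv_cancel₀ RatFunc.X_ne_zero
  exact two_ne_zero (ratFunc_X_pow_injective h1)

/-- A Laurent polynomial in `q^β` that vanishes at `q^β = q^N` for all `N` is zero. -/
theorem eq_zero_of_evalBeta {p : BaseRing} (h : ∀ N, evalBeta N p = 0) : p = 0 := by
  obtain ⟨n, f, hf⟩ := p.exists_T_pow
  have h1 : ∀ N : ℕ, f.eval (RatFunc.X ^ N) = 0 := fun N => by
    have h2 : evalBeta N (Polynomial.toLaurent f) = f.eval (RatFunc.X ^ N) :=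
      LaurentPolynomial.eval₂_toLaurent _ _ _
    rw [← h2, hf, map_mul, h, zero_mul]
  have h2 : f = 0 := Polynomial.eq_zero_of_infinite_isRoot f
    ((Set.infinite_range_of_injective ratFunc_X_pow_injective).mono
      (by rintro _ ⟨N, rfl⟩; exact h1 N))
  rw [h2, map_zero] at hf
  exact ((LaurentPolynomial.isUnit_T n).mul_left_eq_zero).1 hf.symm

/-- A scalar that vanishes in `Br(β)` vanishes at `β = N` for all `N`, by the `gl(N)` state sum of
the empty link. -/
theorem scalarEnd_injective : Function.Injective scalarEnd := by
  refine (injective_iff_map_eq_zero scalarEnd).2 fun p hp => eq_zero_of_evalBeta fun N => ?_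
  have h1 : p • Finsupp.single (Tangle.id []) (1 : BaseRing) ∈ relatorIdeal [] [] := by
    rw [← Submodule.Quotient.mk_eq_zero]
    exact hp
  have h2 := linCol_relatorIdeal N RatFunc.X_ne_zero (evalBeta N)
    (linCol_relator N RatFunc.X_ne_zero (evalBeta N) ratFunc_X_sub_inv_ne_zero
      (evalBeta_C N _) (evalBeta_C N _) (by rw [evalBeta_qBeta, zpow_one])
      (by rw [evalBeta_qBeta, zpow_neg_one]) (evalBeta_betaNumber N)) h1 []
  have h3 : linCol N RatFunc.X_ne_zero (evalBeta N) [] (diag (id [])) = word [] := by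
    rw [linCol_diag, Weights.col_id_nil]
  rw [linCol_smul] at h2
  have h4 := h2.symm.trans (congrArg (evalBeta N p • ·) h3)
  simpa [word] using h4.symm

end Homfly

theorem mainTheorem4 :
    Function.Bijective Homfly.scalarEnd ∧
      ∀ L : Homfly.FramedLink, Homfly.homfly L = Homfly.qFlip (Homfly.homfly L) := by
  have hb : Function.Bijective Homfly.scalarEnd :=
    ⟨Homfly.scalarEnd_injective, Homfly.scalarEnd_surjective⟩
  refine ⟨hb, fun L => ?_⟩
  have h : Homfly.scalarEnd (Homfly.homfly L) = Homfly.quotientFunctor L :=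
    Function.invFun_eq (hb.2 _)
  exact hb.1 (h.trans (Homfly.scalarEnd_qFlip h).symm)
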